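/- Let $E=(E^0,E^1,r,s)$ be an arbitrary directed graph, let $K$ be a field, and let $L=L_K(E)$ be the Leavitt path algebra: the $K$-algebra, not necessarily unital, generated by pairwise orthogonal idempotents $v\in E^0$ and elements $e,e^*$ ($e\in E^1$) subject to $s(e)e=e=e\,r(e)$, $r(e)e^*=e^*=e^*s(e)$, $e^*e=r(e)$, $e^*f=0$ for edges $e\ne f$, and $v=\sum_{s(e)=v}ee^*$ for every vertex $v$ that emits a nonempty finite set of edges. It is $\mathbb Z$-graded, with $L_n$ spanned by the elements $\alpha\beta^*$, where $\alpha,\beta$ are paths (possibly of length $0$) with the same range and $|\alpha|-|\beta|=n$. A cycle is a closed path $e_1\cdots e_n$ ($n\ge1$) with $s(e_i)\neq s(e_j)$ for $i\neq j$; an exit for it is an edge $f$ with $s(f)=s(e_i)$ and $f\ne e_i$ for some $i$. A graded algebra is graded semisimple if, as a right module over itself, it is a sum of graded simple submodules. By a *finite sum of graded matrix rings* we mean a finite (possibly empty) ring direct sum $$\bigoplus_{i}\mathbb M_{n_i}(K)(\delta^{i}_1,\dots,\delta^{i}_{n_i})\ \oplus\ \bigoplus_{j}\mathbb M_{m_j}(K[x^{t_j},x^{-t_j}])(\varepsilon^{j}_1,\dots,\varepsilon^{j}_{m_j}),\qquad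 n_i,m_j,t_j\ge 1,$$ with arbitrary integer shifts, where $K$ has degree $0$, $\deg x=1$, and the $(p,q)$ entry of a matrix of degree $d$ in $\mathbb M_n(R)(\delta_1,\dots,\delta_n)$ lies in $R_{d+\delta_q-\delta_p}$. Theorem 3.6. The following are equivalent: (a) $L$ is graded directly-finite with respect to the vertices: for every vertex $v$ and all homogeneous $x,y\in L$ with $vx=xv=x$ and $vy=yv=y$, $xy=v$ implies $yx=v$; (b) no cycle in $E$ has an exit; (c) $L$ is a directed union of graded subalgebras each of which is graded isomorphic to a graded semisimple Leavitt path algebra $L_K(F)$ of a finite graph $F$ and is also graded isomorphic to a finite sum of graded matrix rings; (c′) $L$ is a directed union of graded subalgebras each of which is graded isomorphic to a finite sum of graded matrix rings; (d) $L$ is directly-finite: for all $x,y\in L$ and every idempotent $u\in L$ with $ux=xu=x$ and $uy=yu=y$, $xy=u$ implies $yx=u$. -/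

import Mathlib

open scoped LaurentPolynomial

universe u v w

/-- A directed graph `E = (E⁰, E¹, r, s)` with vertex set `V`, edge set `A`, source map `s` and
range map `r`. Loops, parallel edges, sinks and infinite emitters are allowed. -/
structure DirectedGraph (V : Type u) (A : Type v) where
  s : A → V
  r : A → V

namespace DirectedGraph

variable {V : Type u} {A : Type v} (E : DirectedGraph V A)

/-- `E.IsPath a p b`: the list of edges `p` is a path from the vertex `a` to the vertex `b`.
The empty list is the path of length `0` at a vertex. -/
def IsPath : V → List A → V → Prop
  | a, [], b => a = b
  | a, e :: p, b => E.s e = a ∧ IsPath (E.r e) p b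

/-- A cycle: a closed path of positive length which does not pass through any of its vertices
twice. -/
def IsCycle (p : List A) : Prop :=
  p ≠ [] ∧ (∃ a, E.IsPath a p a) ∧ (p.map E.s).Nodup

/-- `f` is an exit for the path `p = e₁ ⋯ eₙ`: for some `i`, `s(f) = s(eᵢ)` and `f ≠ eᵢ`. -/
def IsExit (p : List A) (f : A) : Prop :=
  ∃ e ∈ p, E.s f = E.s e ∧ f ≠ e

/-- No cycle in the graph has an exit. -/
def NoCycleHasExit : Prop :=
  ∀ p : List A, E.IsCycle p → ¬ ∃ f, E.IsExit p f

end DirectedGraph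

/-- Generators of a Leavitt path algebra: vertices, edges and ghost edges. -/
inductive LeavittGen (V : Type u) (A : Type v) : Type (max u v)
  | vertex : V → LeavittGen V A
  | edge : A → LeavittGen V A
  | ghost : A → LeavittGen V A

section Leavitt

variable (K : Type w) [Field K] {V : Type u} {A : Type v} (E : DirectedGraph V A)

/-- A generator, as an element of the free unital `K`-algebra on the generators. -/
abbrev LeavittGen.free (g : LeavittGen V A) : FreeAlgebra K (LeavittGen V A) :=
  FreeAlgebra.ι K g

open LeavittGen in
/-- The defining relations of the Leavitt path algebra. -/
inductive LeavittRel :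
    FreeAlgebra K (LeavittGen V A) → FreeAlgebra K (LeavittGen V A) → Prop
  | vertex_idem (a : V) :
      LeavittRel (free K (vertex a) * free K (vertex a)) (free K (vertex a))
  | vertex_orth (a b : V) (h : a ≠ b) :
      LeavittRel (free K (vertex a) * free K (vertex b)) 0
  | source_edge (e : A) :
      LeavittRel (free K (vertex (E.s e)) * free K (edge e)) (free K (edge e))
  | edge_range (e : A) :
      LeavittRel (free K (edge e) * free K (vertex (E.r e))) (free K (edge e))
  | range_ghost (e : A) :
      LeavittRel (free K (vertex (E.r e)) * free K (ghost e)) (free K (ghost e))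
  | ghost_source (e : A) :
      LeavittRel (free K (ghost e) * free K (vertex (E.s e))) (free K (ghost e))
  | ck1_same (e : A) :
      LeavittRel (free K (ghost e) * free K (edge e)) (free K (vertex (E.r e)))
  | ck1_ne (e f : A) (h : e ≠ f) :
      LeavittRel (free K (ghost e) * free K (edge f)) 0
  | ck2 (a : V) (hne : {e : A | E.s e = a}.Nonempty) (hfin : {e : A | E.s e = a}.Finite) :
      LeavittRel (free K (vertex a)) (∑ e ∈ hfin.toFinset, free K (edge e) * free K (ghost e))

/-- The unital `K`-algebra presented by the Leavitt generators and relations. It is the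
unitization of the Leavitt path algebra. -/
abbrev UnitalLeavitt : Type (max u v w) := RingQuot (LeavittRel K E)

/-- The class of a generator in the unital algebra. -/
def unitalLeavittGen (g : LeavittGen V A) : UnitalLeavitt K E :=
  RingQuot.mkAlgHom K (LeavittRel K E) (FreeAlgebra.ι K g)

/-- The Leavitt path algebra `L_K(E)`: the (in general non-unital) `K`-algebra generated by the
vertices, edges and ghost edges subject to the Leavitt relations. No relation has a constant
term, so it is realized as the non-unital subalgebra spanned by the nonempty words in the
generators inside the unital algebra with the same presentation. -/
def LeavittPathAlgebra : Type (max u v w) :=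
  ↥(NonUnitalAlgebra.adjoin K (Set.range (unitalLeavittGen K E)))

namespace LeavittPathAlgebra

instance : NonUnitalRing (LeavittPathAlgebra K E) :=
  inferInstanceAs (NonUnitalRing ↥(NonUnitalAlgebra.adjoin K (Set.range (unitalLeavittGen K E))))

instance : Module K (LeavittPathAlgebra K E) :=
  inferInstanceAs (Module K ↥(NonUnitalAlgebra.adjoin K (Set.range (unitalLeavittGen K E))))

instance : IsScalarTower K (LeavittPathAlgebra K E) (LeavittPathAlgebra K E) :=
  inferInstanceAs (IsScalarTower K ↥(NonUnitalAlgebra.adjoin K (Set.range (unitalLeavittGen K E)))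
    ↥(NonUnitalAlgebra.adjoin K (Set.range (unitalLeavittGen K E))))

instance : SMulCommClass K (LeavittPathAlgebra K E) (LeavittPathAlgebra K E) :=
  inferInstanceAs (SMulCommClass K ↥(NonUnitalAlgebra.adjoin K (Set.range (unitalLeavittGen K E)))
    ↥(NonUnitalAlgebra.adjoin K (Set.range (unitalLeavittGen K E))))

/-- The inclusion of `L_K(E)` into its unitization. -/
def toUnital : LeavittPathAlgebra K E →ₙₐ[K] UnitalLeavitt K E :=
  NonUnitalSubalgebraClass.subtype (NonUnitalAlgebra.adjoin K (Set.range (unitalLeavittGen K E)))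

/-- A generator, as an element of `L_K(E)`. -/
def gen (g : LeavittGen V A) : LeavittPathAlgebra K E :=
  ⟨unitalLeavittGen K E g, NonUnitalAlgebra.subset_adjoin K ⟨g, rfl⟩⟩

/-- The element of `L_K(E)` given by a vertex. -/
def vertex (a : V) : LeavittPathAlgebra K E := gen K E (.vertex a)

/-- The element of `L_K(E)` given by an edge. -/
def edge (e : A) : LeavittPathAlgebra K E := gen K E (.edge e)

/-- The element `e*` of `L_K(E)`. -/
def ghost (e : A) : LeavittPathAlgebra K E := gen K E (.ghost e)

/-- The element `α` of `L_K(E)` given by a path `α` starting at `a`; the path of length `0` at `a`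
gives the vertex `a`. -/
def real : V → List A → LeavittPathAlgebra K E
  | a, [] => vertex K E a
  | _, e :: p => edge K E e * real (E.r e) p

/-- The element `α*` of `L_K(E)` given by a path `α` starting at `a`. -/
def ghostPath : V → List A → LeavittPathAlgebra K E
  | a, [] => vertex K E a
  | _, e :: p => ghostPath (E.r e) p * ghost K E e

/-- The homogeneous component of degree `n` of `L_K(E)`: the span of all `α β*`, where `α` and `β`
are paths with a common range and `|α| - |β| = n`. -/
def component (n : ℤ) : Submodule K (LeavittPathAlgebra K E) :=
  Submodule.span K
    {x | ∃ (a b c : V) (p q : List A), E.IsPath a p c ∧ E.IsPath b q c ∧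
      (p.length : ℤ) - (q.length : ℤ) = n ∧ x = real K E a p * ghostPath K E b q}

end LeavittPathAlgebra

end Leavitt

section Finiteness

/-- A ring with local units is directly-finite if for all `x, y` and every idempotent `e` with
`ex = xe = x` and `ey = ye = y`, the equation `xy = e` implies `yx = e`. -/
def IsDirectlyFinite (R : Type*) [NonUnitalRing R] : Prop :=
  ∀ x y e : R, e * e = e → e * x = x → x * e = x → e * y = y → y * e = y →
    x * y = e → y * x = e

variable {K : Type*} [Field K] {R : Type*} [NonUnitalRing R] [Module K R]

/-- An element is homogeneous if it belongs to some homogeneous component. -/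
def IsHomogeneousElt (𝒜 : ℤ → Submodule K R) (x : R) : Prop :=
  ∃ n, x ∈ 𝒜 n

/-- A graded ring is graded directly-finite with respect to a set `S` of homogeneous idempotents
if for every `e ∈ S` and all homogeneous `x, y` with `ex = xe = x` and `ey = ye = y`, the equation
`xy = e` implies `yx = e`. -/
def IsGradedDirectlyFinite (𝒜 : ℤ → Submodule K R) (S : Set R) : Prop :=
  ∀ e ∈ S, ∀ x y : R, IsHomogeneousElt 𝒜 x → IsHomogeneousElt 𝒜 y →
    e * x = x → x * e = x → e * y = y → y * e = y → x * y = e → y * x = e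

/-- A graded right ideal: a right ideal generated, as a subspace, by its homogeneous elements. -/
def IsGradedRightIdeal (𝒜 : ℤ → Submodule K R) (I : Submodule K R) : Prop :=
  (∀ x ∈ I, ∀ y : R, x * y ∈ I) ∧ I ≤ ⨆ n, I ⊓ 𝒜 n

/-- A graded simple right ideal: a nonzero graded right ideal which contains no graded right
ideals other than `0` and itself. -/
def IsGradedSimpleRightIdeal (𝒜 : ℤ → Submodule K R) (I : Submodule K R) : Prop :=
  IsGradedRightIdeal 𝒜 I ∧ I ≠ ⊥ ∧
    ∀ J : Submodule K R, IsGradedRightIdeal 𝒜 J → J ≤ I → J = ⊥ ∨ J = I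

/-- A graded algebra (with identity, or with local units) is graded semisimple if it is, as a
right module over itself, a sum of graded simple submodules. -/
def IsGradedSemisimple (𝒜 : ℤ → Submodule K R) : Prop :=
  sSup {I : Submodule K R | IsGradedSimpleRightIdeal 𝒜 I} = ⊤

/-- Two graded `K`-algebras are graded isomorphic. -/
def GradedIsomorphic {S : Type*} [NonUnitalRing S] [Module K S]
    (𝒜 : ℤ → Submodule K R) (ℬ : ℤ → Submodule K S) : Prop :=
  ∃ φ : R →ₙₐ[K] S, Function.Bijective φ ∧ ∀ (n : ℤ) (x : R), x ∈ 𝒜 n ↔ φ x ∈ ℬ n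

/-- The family of subspaces `B ∩ 𝒜ₙ` of a subalgebra `B`. -/
def inducedGrading (𝒜 : ℤ → Submodule K R) (B : NonUnitalSubalgebra K R) (n : ℤ) :
    Submodule K B where
  carrier := {b | (b : R) ∈ 𝒜 n}
  add_mem' := fun ha hb => (𝒜 n).add_mem ha hb
  zero_mem' := (𝒜 n).zero_mem
  smul_mem' := fun c _ hb => (𝒜 n).smul_mem c hb

/-- A graded subalgebra: every element of `B` is a sum of homogeneous elements of `B`. -/
def IsGradedSubalgebra (𝒜 : ℤ → Submodule K R) (B : NonUnitalSubalgebra K R) : Prop :=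
  ⨆ n, inducedGrading 𝒜 B n = ⊤

/-- `R` is a directed union of graded subalgebras having the property `P`. -/
def IsDirectedUnionOfGraded (𝒜 : ℤ → Submodule K R) (P : NonUnitalSubalgebra K R → Prop) :
    Prop :=
  ∃ 𝒮 : Set (NonUnitalSubalgebra K R),
    DirectedOn (· ≤ ·) 𝒮 ∧ (∀ x : R, ∃ B ∈ 𝒮, x ∈ B) ∧
      ∀ B ∈ 𝒮, IsGradedSubalgebra 𝒜 B ∧ P B

end Finiteness

section Matrices

variable (K : Type*) [Field K]

/-- The field `K`, concentrated in degree `0`. -/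
def trivialGrading (d : ℤ) : Submodule K K where
  carrier := {c | c ≠ 0 → d = 0}
  add_mem' := by
    intro a b ha hb hab
    by_cases h : a = 0
    · exact hb (by simpa [h] using hab)
    · exact ha h
  zero_mem' := fun h => absurd rfl h
  smul_mem' := fun c x hx h => hx (right_ne_zero_of_mul h)

/-- The grading of the Laurent polynomial ring `K[T, T⁻¹]` in which `T` has degree `t`; that is,
the ring `K[x^t, x^{-t}]`, where `x` has degree `1` and `T = x^t`. -/
noncomputable def laurentGrading (t : ℕ) (d : ℤ) : Submodule K K[T;T⁻¹] :=
  Submodule.span K {f | ∃ m : ℤ, (t : ℤ) * m = d ∧ f = LaurentPolynomial.T m}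

variable {K}

/-- The matrix grading `M_n(R)(δ₁, …, δₙ)`: the `(i, j)` entry of a matrix of degree `d` has degree
`d + δⱼ - δᵢ`. -/
def matrixGrading {R : Type*} [Ring R] [Algebra K R] (𝒜 : ℤ → Submodule K R) {n : ℕ}
    (δ : Fin n → ℤ) (d : ℤ) : Submodule K (Matrix (Fin n) (Fin n) R) where
  carrier := {M | ∀ i j, M i j ∈ 𝒜 (d + δ j - δ i)}
  add_mem' := fun ha hb i j => Submodule.add_mem _ (ha i j) (hb i j)
  zero_mem' := fun _ _ => Submodule.zero_mem _
  smul_mem' := fun c _ h i j => Submodule.smul_mem _ c (h i j)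

/-- The numerical data of a finite direct sum of graded matrix rings of finite order over `K` and
over `K[x^t, x^{-t}]`, `t ≥ 1`. -/
structure MatrixSumShape where
  /-- the number of summands over `K` -/
  a : ℕ
  /-- the number of summands over Laurent polynomial rings -/
  b : ℕ
  /-- the orders of the matrices over `K` -/
  n : Fin a → ℕ
  /-- the orders of the matrices over Laurent polynomial rings -/
  m : Fin b → ℕ
  n_pos : ∀ i, 0 < n i
  m_pos : ∀ j, 0 < m j
  /-- the degree of the variable `T = x^t` in each Laurent polynomial ring -/
  t : Fin b → ℕ
  t_pos : ∀ j, 0 < t j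
  /-- the shifts of the matrix gradings -/
  δ : ∀ i, Fin (n i) → ℤ
  ε : ∀ j, Fin (m j) → ℤ

namespace MatrixSumShape

variable (K) (D : MatrixSumShape)

/-- The ring `⨁ᵢ M_{nᵢ}(K) ⊕ ⨁ⱼ M_{mⱼ}(K[x^{tⱼ}, x^{-tⱼ}])`, with componentwise operations. -/
abbrev Carrier : Type _ :=
  (∀ i : Fin D.a, Matrix (Fin (D.n i)) (Fin (D.n i)) K) ×
    (∀ j : Fin D.b, Matrix (Fin (D.m j)) (Fin (D.m j)) K[T;T⁻¹])

/-- The componentwise grading of the direct sum by the matrix gradings of the summands. -/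
noncomputable def grading (d : ℤ) : Submodule K (D.Carrier K) where
  carrier := {M | (∀ i, M.1 i ∈ matrixGrading (trivialGrading K) (D.δ i) d) ∧
    ∀ j, M.2 j ∈ matrixGrading (laurentGrading K (D.t j)) (D.ε j) d}
  add_mem' := fun ha hb => ⟨fun i => Submodule.add_mem _ (ha.1 i) (hb.1 i),
    fun j => Submodule.add_mem _ (ha.2 j) (hb.2 j)⟩
  zero_mem' := ⟨fun _ => Submodule.zero_mem _, fun _ => Submodule.zero_mem _⟩
  smul_mem' := fun c _ h => ⟨fun i => Submodule.smul_mem _ c (h.1 i),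
    fun j => Submodule.smul_mem _ c (h.2 j)⟩

end MatrixSumShape

/-- A graded algebra is graded isomorphic to a finite direct sum of graded matrix rings of finite
order over `K` and over `K[x^t, x^{-t}]`, `t ≥ 1`. -/
def IsGradedMatrixSum {R : Type*} [NonUnitalRing R] [Module K R] (𝒜 : ℤ → Submodule K R) : Prop :=
  ∃ D : MatrixSumShape, GradedIsomorphic 𝒜 (D.grading K)

/-- A graded algebra is graded isomorphic to a graded semisimple Leavitt path algebra `L_K(F)` of a
finite graph `F`. -/
def IsGradedSemisimpleLeavitt {R : Type*} [NonUnitalRing R] [Module K R]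
    (𝒜 : ℤ → Submodule K R) : Prop :=
  ∃ (V' A' : Type) (_ : Finite V') (_ : Finite A') (F : DirectedGraph V' A'),
    IsGradedSemisimple (LeavittPathAlgebra.component K F) ∧
      GradedIsomorphic 𝒜 (LeavittPathAlgebra.component K F)

end Matrices

/-!
The difficult step leads from the absence of exits to the directed union of matrix rings; the other
implications are short. A closed path `α` at `v` satisfies `α* α = v`, and an exit of `α` prevents
`α α* = v`, so graded direct finiteness excludes exits
(`noCycleHasExit_of_isGradedDirectlyFinite`). This needs that vertices are nonzero in `L_K(E)`, for
which an explicit representation is constructed (`vertex_ne_zero`). Conversely, every corner of a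
finite sum of matrix rings over `K` and `K[T, T⁻¹]` is directly finite because one-sided inverses of
matrices over a commutative ring are two-sided, and three given elements of a directed union lie in
one of its members (`isDirectlyFinite_of_isDirectedUnionOfGraded`).

Suppose now that no cycle of `E` has an exit.

*Finite graphs.* If `E` is finite, let `W` be a minimal set of vertices which contains all sinks and
meets every cycle. Then a vertex of `W` is a sink or the only vertex of `W` on a cycle `c`, from
which nothing branches off (`exists_isTerminal`). For `w ∈ W` consider the paths which end in `w`
and are stopped at their first visit to `W`. There are finitely many of them, none is a proper
beginning of another one, and every vertex `v` is the sum of the `p p*` with `p` starting at `v`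
(`exists_vertex_eq_sum`). Hence the elements `p q*`, respectively `p cᵏ q*`, are the matrix units of
a matrix ring over `K`, respectively over the Laurent polynomials in `c`, and `L_K(E)` is the
direct sum of these rings over `w ∈ W`, the path `p` having shift `|p|` (`exists_matrixSystem`).
Consequently every nonzero homogeneous element divides a vertex. It follows that the right ideals
`p p* L` are graded simple, which gives graded semisimplicity, and that a graded homomorphism which
kills no vertex is injective (`injective_of_map_vertex_ne_zero`).

*Arbitrary graphs.* `L_K(E)` is the directed union of the subalgebras generated by finite subgraphs
`G`. In such a subalgebra a vertex `x` of `G` splits into `∑ e e*`, over the edges of `G` from `x`,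
and the difference `x - ∑ e e*`. The second part vanishes if `x` emits edges and they are all in
`G`; the first part vanishes if `x` emits no edges in `G`. The nonvanishing parts are the vertices
of a finite graph (`splitGraph`) in which no cycle has an exit either, and by the uniqueness theorem
its Leavitt path algebra is isomorphic to the subalgebra
(`subgraphAlgebra_isGradedSubalgebra_and_gradedIsomorphic`).
-/

/-! ### Relations and the universal property -/

/-- A Leavitt `E`-family in a non-unital ring `R`: elements indexed by vertices, edges and ghost
edges which satisfy the defining relations of the Leavitt path algebra. -/
structure LeavittFamily {V : Type*} {A : Type*} (E : DirectedGraph V A) (R : Type*)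
    [NonUnitalRing R] where
  vertex : V → R
  edge : A → R
  ghost : A → R
  vertex_idem : ∀ a, vertex a * vertex a = vertex a
  vertex_orth : ∀ a b, a ≠ b → vertex a * vertex b = 0
  source_edge : ∀ e, vertex (E.s e) * edge e = edge e
  edge_range : ∀ e, edge e * vertex (E.r e) = edge e
  range_ghost : ∀ e, vertex (E.r e) * ghost e = ghost e
  ghost_source : ∀ e, ghost e * vertex (E.s e) = ghost e
  ck1_same : ∀ e, ghost e * edge e = vertex (E.r e)
  ck1_ne : ∀ e f, e ≠ f → ghost e * edge f = 0
  ck2 : ∀ a, {e : A | E.s e = a}.Nonempty → ∀ hfin : {e : A | E.s e = a}.Finite,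
    vertex a = ∑ e ∈ hfin.toFinset, edge e * ghost e

namespace LeavittPathAlgebra

variable (K : Type w) [Field K] {V : Type u} {A : Type v} (E : DirectedGraph V A)

theorem toUnital_injective : Function.Injective (toUnital K E) := Subtype.val_injective

/-- The generators of `L_K(E)` form a Leavitt `E`-family. -/
def family : LeavittFamily E (LeavittPathAlgebra K E) where
  vertex := vertex K E
  edge := edge K E
  ghost := ghost K E
  vertex_idem a := toUnital_injective K E <|
    (map_mul _ _ _).symm.trans (RingQuot.mkAlgHom_rel K (LeavittRel.vertex_idem a))
  vertex_orth a b h := toUnital_injective K E <|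
    (map_mul _ _ _).symm.trans ((RingQuot.mkAlgHom_rel K (LeavittRel.vertex_orth a b h)).trans
      (map_zero _))
  source_edge e := toUnital_injective K E <|
    (map_mul _ _ _).symm.trans (RingQuot.mkAlgHom_rel K (LeavittRel.source_edge e))
  edge_range e := toUnital_injective K E <|
    (map_mul _ _ _).symm.trans (RingQuot.mkAlgHom_rel K (LeavittRel.edge_range e))
  range_ghost e := toUnital_injective K E <|
    (map_mul _ _ _).symm.trans (RingQuot.mkAlgHom_rel K (LeavittRel.range_ghost e))
  ghost_source e := toUnital_injective K E <|
    (map_mul _ _ _).symm.trans (RingQuot.mkAlgHom_rel K (LeavittRel.ghost_source e))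
  ck1_same e := toUnital_injective K E <|
    (map_mul _ _ _).symm.trans (RingQuot.mkAlgHom_rel K (LeavittRel.ck1_same e))
  ck1_ne e f h := toUnital_injective K E <|
    (map_mul _ _ _).symm.trans ((RingQuot.mkAlgHom_rel K (LeavittRel.ck1_ne e f h)).trans
      (map_zero _))
  ck2 a hne hfin := toUnital_injective K E <| by
    have h := RingQuot.mkAlgHom_rel K (LeavittRel.ck2 (K := K) (E := E) a hne hfin)
    rw [map_sum] at h ⊢
    simp only [map_mul] at h ⊢
    exact h

variable {K E}

theorem vertex_mul_self (a : V) : vertex K E a * vertex K E a = vertex K E a :=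
  (family K E).vertex_idem a

theorem vertex_mul_vertex_of_ne {a b : V} (h : a ≠ b) : vertex K E a * vertex K E b = 0 :=
  (family K E).vertex_orth a b h

theorem vertex_mul_edge (e : A) : vertex K E (E.s e) * edge K E e = edge K E e :=
  (family K E).source_edge e

theorem edge_mul_vertex (e : A) : edge K E e * vertex K E (E.r e) = edge K E e :=
  (family K E).edge_range e

theorem vertex_mul_ghost (e : A) : vertex K E (E.r e) * ghost K E e = ghost K E e :=
  (family K E).range_ghost e

theorem ghost_mul_vertex (e : A) : ghost K E e * vertex K E (E.s e) = ghost K E e :=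
  (family K E).ghost_source e

theorem ghost_mul_edge_self (e : A) : ghost K E e * edge K E e = vertex K E (E.r e) :=
  (family K E).ck1_same e

theorem ghost_mul_edge_of_ne {e f : A} (h : e ≠ f) : ghost K E e * edge K E f = 0 :=
  (family K E).ck1_ne e f h

theorem vertex_eq_sum (a : V) (hne : {e : A | E.s e = a}.Nonempty)
    (hfin : {e : A | E.s e = a}.Finite) :
    vertex K E a = ∑ e ∈ hfin.toFinset, edge K E e * ghost K E e :=
  (family K E).ck2 a hne hfin

theorem ghost_mul_vertex_of_ne {a : V} {e : A} (h : E.s e ≠ a) :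
    ghost K E e * vertex K E a = 0 := by
  rw [← ghost_mul_vertex e, mul_assoc, vertex_mul_vertex_of_ne h, mul_zero]

theorem adjoin_gen_eq_top :
    NonUnitalAlgebra.adjoin K (Set.range (gen K E)) = ⊤ := by
  refine eq_top_iff.2 fun x _ => ?_
  obtain ⟨x, hx⟩ := x
  induction hx using NonUnitalAlgebra.adjoin_induction with
  | mem x h =>
    obtain ⟨g, rfl⟩ := h
    exact NonUnitalAlgebra.subset_adjoin K ⟨g, rfl⟩
  | zero => exact zero_mem (NonUnitalAlgebra.adjoin K (Set.range (gen K E)))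
  | add x y hx hy h1 h2 =>
    exact add_mem (S := NonUnitalSubalgebra K (LeavittPathAlgebra K E)) (h1 trivial) (h2 trivial)
  | mul x y hx hy h1 h2 =>
    exact mul_mem (S := NonUnitalSubalgebra K (LeavittPathAlgebra K E)) (h1 trivial) (h2 trivial)
  | smul r x hx h =>
    exact SMulMemClass.smul_mem (S := NonUnitalSubalgebra K (LeavittPathAlgebra K E)) r (h trivial)

/-- A subalgebra of `L_K(E)` which contains the vertices, the edges and the ghost edges is
everything. -/
theorem mem_of_generators (B : NonUnitalSubalgebra K (LeavittPathAlgebra K E))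
    (hv : ∀ a, vertex K E a ∈ B) (he : ∀ e, edge K E e ∈ B) (hg : ∀ e, ghost K E e ∈ B)
    (x : LeavittPathAlgebra K E) : x ∈ B := by
  have h : NonUnitalAlgebra.adjoin K (Set.range (gen K E)) ≤ B := by
    refine NonUnitalAlgebra.adjoin_le ?_
    rintro _ ⟨g | g | g, rfl⟩
    exacts [hv g, he g, hg g]
  exact h (adjoin_gen_eq_top (K := K) (E := E) ▸ trivial)

end LeavittPathAlgebra

namespace LeavittFamily

variable {K : Type w} [Field K] {V : Type u} {A : Type v} {E : DirectedGraph V A}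
  {R : Type*} [NonUnitalRing R] [Module K R] [IsScalarTower K R R] [SMulCommClass K R R]
  (φ : LeavittFamily E R)

/-- The family as a function of the generators. -/
def ofGen : LeavittGen V A → R
  | .vertex a => φ.vertex a
  | .edge e => φ.edge e
  | .ghost e => φ.ghost e

variable (K) in
/-- The homomorphism from the unital algebra with the Leavitt presentation to the unitization of
`R` which is given by a Leavitt family in `R`. -/
noncomputable def liftUnital : UnitalLeavitt K E →ₐ[K] Unitization K R :=
  RingQuot.liftAlgHom K ⟨FreeAlgebra.lift K fun g => (φ.ofGen g : Unitization K R), by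
    intro x y h
    cases h <;>
      simp only [LeavittGen.free, map_mul, map_sum, map_zero, FreeAlgebra.lift_ι_apply, ofGen,
        ← Unitization.inr_mul]
    case vertex_idem a => rw [φ.vertex_idem]
    case vertex_orth a b h => rw [φ.vertex_orth a b h, Unitization.inr_zero]
    case source_edge => rw [φ.source_edge]
    case edge_range => rw [φ.edge_range]
    case range_ghost => rw [φ.range_ghost]
    case ghost_source => rw [φ.ghost_source]
    case ck1_same => rw [φ.ck1_same]
    case ck1_ne e f h => rw [φ.ck1_ne e f h, Unitization.inr_zero]
    case ck2 a hne hfin =>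
      rw [φ.ck2 a hne hfin]
      exact map_sum (Unitization.inrNonUnitalAlgHom K R) _ _⟩

theorem liftUnital_gen (g : LeavittGen V A) :
    φ.liftUnital K (unitalLeavittGen K E g) = (φ.ofGen g : Unitization K R) := by
  rw [liftUnital, unitalLeavittGen, RingQuot.liftAlgHom_mkAlgHom_apply, FreeAlgebra.lift_ι_apply]

theorem fst_liftUnital (x : LeavittPathAlgebra K E) :
    (φ.liftUnital K (LeavittPathAlgebra.toUnital K E x)).fst = 0 := by
  obtain ⟨x, hx⟩ := x
  change (φ.liftUnital K x).fst = 0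
  induction hx using NonUnitalAlgebra.adjoin_induction with
  | mem x h => obtain ⟨g, rfl⟩ := h; rw [liftUnital_gen, Unitization.fst_inr]
  | zero => simp
  | add x y hx hy h1 h2 => simp [h1, h2]
  | mul x y hx hy h1 h2 => simp [h1, h2]
  | smul r x hx h => simp [h]

variable (K) in
/-- The universal property of `L_K(E)`: a Leavitt `E`-family in `R` extends to a homomorphism. -/
noncomputable def lift : LeavittPathAlgebra K E →ₙₐ[K] R where
  toFun x := (φ.liftUnital K (LeavittPathAlgebra.toUnital K E x)).snd
  map_smul' r x := by simp
  map_zero' := by simp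
  map_add' x y := by simp
  map_mul' x y := by simp [fst_liftUnital]

theorem lift_vertex (a : V) : φ.lift K (LeavittPathAlgebra.vertex K E a) = φ.vertex a :=
  congrArg (fun z : Unitization K R => z.snd) (φ.liftUnital_gen (K := K) (.vertex a))

theorem lift_edge (e : A) : φ.lift K (LeavittPathAlgebra.edge K E e) = φ.edge e :=
  congrArg (fun z : Unitization K R => z.snd) (φ.liftUnital_gen (K := K) (.edge e))

theorem lift_ghost (e : A) : φ.lift K (LeavittPathAlgebra.ghost K E e) = φ.ghost e :=
  congrArg (fun z : Unitization K R => z.snd) (φ.liftUnital_gen (K := K) (.ghost e))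

end LeavittFamily

/-! ### The grading -/

namespace DirectedGraph

variable {V : Type u} {A : Type v} {E : DirectedGraph V A}

theorem isPath_append {a b c : V} {p q : List A} :
    E.IsPath a p b → E.IsPath b q c → E.IsPath a (p ++ q) c := by
  induction p generalizing a with
  | nil => rintro rfl h; exact h
  | cons e p ih => rintro ⟨h1, h2⟩ h; exact ⟨h1, ih h2 h⟩

theorem IsPath.exists_of_append {a c : V} {p q : List A} :
    E.IsPath a (p ++ q) c → ∃ b, E.IsPath a p b ∧ E.IsPath b q c := by
  induction p generalizing a with
  | nil => intro h; exact ⟨a, rfl, h⟩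
  | cons e p ih =>
    rintro ⟨h1, h2⟩
    obtain ⟨b, h3, h4⟩ := ih h2
    exact ⟨b, ⟨h1, h3⟩, h4⟩

end DirectedGraph

namespace LeavittPathAlgebra

variable {K : Type w} [Field K] {V : Type u} {A : Type v} {E : DirectedGraph V A}

theorem vertex_mul_real {a c : V} {p : List A} (h : E.IsPath a p c) :
    vertex K E a * real K E a p = real K E a p := by
  cases p with
  | nil => exact vertex_mul_self a
  | cons e p => rw [real, ← h.1, ← mul_assoc, vertex_mul_edge]

theorem vertex_mul_real_of_ne {a b c : V} {p : List A} (h : E.IsPath a p c) (hb : b ≠ a) :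
    vertex K E b * real K E a p = 0 := by
  rw [← vertex_mul_real h, ← mul_assoc, vertex_mul_vertex_of_ne hb, zero_mul]

theorem real_mul_vertex {a c : V} {p : List A} (h : E.IsPath a p c) :
    real K E a p * vertex K E c = real K E a p := by
  induction p generalizing a with
  | nil => cases h; exact vertex_mul_self _
  | cons e p ih => rw [real, mul_assoc, ih h.2]

theorem ghostPath_mul_vertex {a c : V} {p : List A} (h : E.IsPath a p c) :
    ghostPath K E a p * vertex K E a = ghostPath K E a p := by
  cases p with
  | nil => exact vertex_mul_self a
  | cons e p => rw [ghostPath, ← h.1, mul_assoc, ghost_mul_vertex]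

theorem vertex_mul_ghostPath {a c : V} {p : List A} (h : E.IsPath a p c) :
    vertex K E c * ghostPath K E a p = ghostPath K E a p := by
  induction p generalizing a with
  | nil => cases h; exact vertex_mul_self _
  | cons e p ih => rw [ghostPath, ← mul_assoc, ih h.2]

theorem real_append {a b c : V} {p q : List A} (hp : E.IsPath a p b) (hq : E.IsPath b q c) :
    real K E a (p ++ q) = real K E a p * real K E b q := by
  induction p generalizing a with
  | nil => cases hp; exact (vertex_mul_real hq).symm
  | cons e p ih => rw [List.cons_append, real, ih hp.2, real, mul_assoc]

theorem ghostPath_append {a b c : V} {p q : List A} (hp : E.IsPath a p b)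
    (hq : E.IsPath b q c) :
    ghostPath K E a (p ++ q) = ghostPath K E b q * ghostPath K E a p := by
  induction p generalizing a with
  | nil => cases hp; exact (ghostPath_mul_vertex hq).symm
  | cons e p ih => rw [List.cons_append, ghostPath, ih hp.2, ghostPath, mul_assoc]

theorem ghostPath_mul_real_self {a c : V} {p : List A} (h : E.IsPath a p c) :
    ghostPath K E a p * real K E a p = vertex K E c := by
  induction p generalizing a with
  | nil => cases h; exact vertex_mul_self _
  | cons e p ih =>
    rw [ghostPath, real, mul_assoc, ← mul_assoc (ghost K E e), ghost_mul_edge_self,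
      vertex_mul_real h.2, ih h.2]

variable (K E) in
/-- The Leavitt family obtained by attaching to every generator the power of `T` given by its
degree. -/
noncomputable def degFamily : LeavittFamily E (UnitalLeavitt K E)[T;T⁻¹] where
  vertex a := AddMonoidAlgebra.single 0 (toUnital K E (vertex K E a))
  edge e := AddMonoidAlgebra.single 1 (toUnital K E (edge K E e))
  ghost e := AddMonoidAlgebra.single (-1) (toUnital K E (ghost K E e))
  vertex_idem a := by
    rw [AddMonoidAlgebra.single_mul_single, ← map_mul, vertex_mul_self, add_zero]
  vertex_orth a b h := by
    rw [AddMonoidAlgebra.single_mul_single, ← map_mul, vertex_mul_vertex_of_ne h, map_zero,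
      AddMonoidAlgebra.single_zero]
  source_edge e := by
    rw [AddMonoidAlgebra.single_mul_single, ← map_mul, vertex_mul_edge, zero_add]
  edge_range e := by
    rw [AddMonoidAlgebra.single_mul_single, ← map_mul, edge_mul_vertex, add_zero]
  range_ghost e := by
    rw [AddMonoidAlgebra.single_mul_single, ← map_mul, vertex_mul_ghost, zero_add]
  ghost_source e := by
    rw [AddMonoidAlgebra.single_mul_single, ← map_mul, ghost_mul_vertex, add_zero]
  ck1_same e := by
    rw [AddMonoidAlgebra.single_mul_single, ← map_mul, ghost_mul_edge_self, neg_add_cancel]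
  ck1_ne e f h := by
    rw [AddMonoidAlgebra.single_mul_single, ← map_mul, ghost_mul_edge_of_ne h, map_zero,
      AddMonoidAlgebra.single_zero]
  ck2 a hne hfin := by
    simp_rw [AddMonoidAlgebra.single_mul_single, ← map_mul, add_neg_cancel]
    rw [vertex_eq_sum a hne hfin, map_sum]
    exact map_sum (AddMonoidAlgebra.singleAddHom (R := UnitalLeavitt K E) (0 : ℤ)) _ _

variable (K E) in
/-- The homomorphism which records degrees: it sends `x` of degree `n` to `x Tⁿ`. -/
noncomputable def degHom : LeavittPathAlgebra K E →ₙₐ[K] (UnitalLeavitt K E)[T;T⁻¹] :=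
  (degFamily K E).lift K

theorem degHom_vertex (a : V) :
    degHom K E (vertex K E a) = .single 0 (toUnital K E (vertex K E a)) :=
  LeavittFamily.lift_vertex (degFamily K E) a

theorem degHom_edge (e : A) :
    degHom K E (edge K E e) = .single 1 (toUnital K E (edge K E e)) :=
  LeavittFamily.lift_edge (degFamily K E) e

theorem degHom_ghost (e : A) :
    degHom K E (ghost K E e) = .single (-1) (toUnital K E (ghost K E e)) :=
  LeavittFamily.lift_ghost (degFamily K E) e

theorem degHom_real (a : V) (p : List A) :
    degHom K E (real K E a p) = .single (p.length : ℤ) (toUnital K E (real K E a p)) := by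
  induction p generalizing a with
  | nil => exact degHom_vertex a
  | cons e p ih =>
    rw [real, map_mul, degHom_edge, ih, AddMonoidAlgebra.single_mul_single, ← map_mul]
    congr 1
    push_cast [List.length_cons]
    ring

theorem degHom_ghostPath (a : V) (p : List A) :
    degHom K E (ghostPath K E a p) =
      .single (-(p.length : ℤ)) (toUnital K E (ghostPath K E a p)) := by
  induction p generalizing a with
  | nil => exact degHom_vertex a
  | cons e p ih =>
    rw [ghostPath, map_mul, degHom_ghost, ih, AddMonoidAlgebra.single_mul_single, ← map_mul]
    congr 1
    push_cast [List.length_cons]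
    ring

theorem degHom_of_mem {n : ℤ} {x : LeavittPathAlgebra K E} (hx : x ∈ component K E n) :
    degHom K E x = .single n (toUnital K E x) := by
  induction hx using Submodule.span_induction with
  | mem x h =>
    obtain ⟨a, b, c, p, q, -, -, hn, rfl⟩ := h
    rw [map_mul, degHom_real, degHom_ghostPath, AddMonoidAlgebra.single_mul_single, ← map_mul,
      ← hn, sub_eq_add_neg]
  | zero => rw [map_zero, map_zero, AddMonoidAlgebra.single_zero]
  | add x y _ _ h1 h2 => rw [map_add, map_add, h1, h2, AddMonoidAlgebra.single_add]
  | smul r x _ h => rw [map_smul, map_smul, h, AddMonoidAlgebra.smul_single]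

variable (K E) in
/-- The projection of `L_K(E)` to its component of degree `n`, with values in the unitization. -/
noncomputable def proj (n : ℤ) : LeavittPathAlgebra K E →ₗ[K] UnitalLeavitt K E where
  toFun x := (degHom K E x).coeff n
  map_add' x y := by rw [map_add]; rfl
  map_smul' r x := by rw [map_smul]; rfl

theorem proj_of_mem {n : ℤ} {x : LeavittPathAlgebra K E} (hx : x ∈ component K E n) :
    proj K E n x = toUnital K E x := by
  change (degHom K E x).coeff n = _
  rw [degHom_of_mem hx, AddMonoidAlgebra.coeff_single, Finsupp.single_eq_same]

theorem proj_of_mem_of_ne {m n : ℤ} {x : LeavittPathAlgebra K E} (hx : x ∈ component K E m)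
    (h : m ≠ n) : proj K E n x = 0 := by
  change (degHom K E x).coeff n = _
  rw [degHom_of_mem hx, AddMonoidAlgebra.coeff_single, Finsupp.single_eq_of_ne' h]

theorem eq_zero_of_mem_of_mem {m n : ℤ} {x : LeavittPathAlgebra K E} (hm : x ∈ component K E m)
    (hn : x ∈ component K E n) (h : m ≠ n) : x = 0 :=
  toUnital_injective K E <| by rw [← proj_of_mem hn, proj_of_mem_of_ne hm h, map_zero]

variable (K E) in
/-- The span of all elements `α β*`; it turns out to be everything. -/
def monomialSpan : Submodule K (LeavittPathAlgebra K E) :=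
  Submodule.span K
    {x | ∃ (a b c : V) (p q : List A), E.IsPath a p c ∧ E.IsPath b q c ∧
      x = real K E a p * ghostPath K E b q}

theorem monomial_mem {a b c : V} {p q : List A} (hp : E.IsPath a p c) (hq : E.IsPath b q c) :
    real K E a p * ghostPath K E b q ∈ monomialSpan K E :=
  Submodule.subset_span ⟨a, b, c, p, q, hp, hq, rfl⟩

theorem mul_mem_monomialSpan (x y : LeavittPathAlgebra K E) (hy : y ∈ monomialSpan K E) :
    x * y ∈ monomialSpan K E := by
  let B : NonUnitalSubalgebra K (LeavittPathAlgebra K E) :=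
    { carrier := {x | ∀ y ∈ monomialSpan K E, x * y ∈ monomialSpan K E}
      add_mem' := fun h1 h2 y hy => by rw [add_mul]; exact add_mem (h1 y hy) (h2 y hy)
      zero_mem' := fun y _ => by rw [zero_mul]; exact zero_mem _
      mul_mem' := fun h1 h2 y hy => by rw [mul_assoc]; exact h1 _ (h2 y hy)
      smul_mem' := fun r x h y hy => by
        rw [smul_mul_assoc]; exact Submodule.smul_mem _ r (h y hy) }
  have key : ∀ z : LeavittPathAlgebra K E, (∀ (a b c : V) (p q : List A), E.IsPath a p c →
      E.IsPath b q c → z * (real K E a p * ghostPath K E b q) ∈ monomialSpan K E) → z ∈ B := by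
    intro z hz y hy
    induction hy using Submodule.span_induction with
    | mem y h => obtain ⟨a, b, c, p, q, hp, hq, rfl⟩ := h; exact hz a b c p q hp hq
    | zero => rw [mul_zero]; exact zero_mem _
    | add y y' _ _ h1 h2 => rw [mul_add]; exact add_mem h1 h2
    | smul r y _ h => rw [mul_smul_comm]; exact Submodule.smul_mem _ r h
  refine mem_of_generators B (fun v => key _ ?_) (fun e => key _ ?_) (fun e => key _ ?_) x y hy
  · intro a b c p q hp hq
    rw [← mul_assoc]
    by_cases h : v = a
    · subst h; rw [vertex_mul_real hp]; exact monomial_mem hp hq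
    · rw [vertex_mul_real_of_ne hp h, zero_mul]; exact zero_mem _
  · intro a b c p q hp hq
    rw [← mul_assoc]
    by_cases h : E.r e = a
    · subst h
      exact monomial_mem (a := E.s e) (p := e :: p) ⟨rfl, hp⟩ hq
    · rw [← edge_mul_vertex, mul_assoc (edge K E e), vertex_mul_real_of_ne hp h, mul_zero,
        zero_mul]
      exact zero_mem _
  · intro a b c p q hp hq
    cases p with
    | nil =>
      cases hp
      rw [real, vertex_mul_ghostPath hq]
      by_cases h : E.s e = a
      · have h1 : E.IsPath b (q ++ [e]) (E.r e) :=
          DirectedGraph.isPath_append (q := [e]) hq ⟨h, rfl⟩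
        have h2 : ghost K E e * ghostPath K E b q =
            real K E (E.r e) [] * ghostPath K E b (q ++ [e]) := by
          rw [real, vertex_mul_ghostPath h1,
            ghostPath_append (c := E.r e) (q := [e]) hq ⟨h, rfl⟩, ghostPath, ghostPath,
            vertex_mul_ghost]
        rw [h2]
        exact monomial_mem rfl h1
      · rw [← vertex_mul_ghostPath hq, ← mul_assoc, ghost_mul_vertex_of_ne h, zero_mul]
        exact zero_mem _
    | cons f p =>
      rw [real, ← mul_assoc, ← mul_assoc]
      by_cases h : e = f
      · subst h
        rw [ghost_mul_edge_self, vertex_mul_real hp.2]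
        exact monomial_mem hp.2 hq
      · rw [ghost_mul_edge_of_ne h, zero_mul, zero_mul]
        exact zero_mem _

theorem edge_eq_monomial (e : A) :
    edge K E e = real K E (E.s e) [e] * ghostPath K E (E.r e) [] := by
  rw [real, real, ghostPath, mul_assoc, vertex_mul_self, edge_mul_vertex]

theorem ghost_eq_monomial (e : A) :
    ghost K E e = real K E (E.r e) [] * ghostPath K E (E.s e) [e] := by
  rw [real, ghostPath, ghostPath, ← mul_assoc, vertex_mul_self, vertex_mul_ghost]

theorem monomialSpan_eq_top : monomialSpan K E = ⊤ := by
  refine eq_top_iff.2 fun x _ => ?_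
  refine mem_of_generators
    { monomialSpan K E with mul_mem' := fun {x y} _ hy => mul_mem_monomialSpan x y hy }
    (fun a => ?_) (fun e => ?_) (fun e => ?_) x
  · change vertex K E a ∈ monomialSpan K E
    rw [← vertex_mul_self a]
    exact monomial_mem (p := []) (q := []) rfl rfl
  · change edge K E e ∈ monomialSpan K E
    rw [edge_eq_monomial]
    exact monomial_mem ⟨rfl, rfl⟩ rfl
  · change ghost K E e ∈ monomialSpan K E
    rw [ghost_eq_monomial]
    exact monomial_mem rfl ⟨rfl, rfl⟩

theorem iSup_component : ⨆ n, component K E n = ⊤ := by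
  rw [eq_top_iff, ← monomialSpan_eq_top, monomialSpan, Submodule.span_le]
  rintro _ ⟨a, b, c, p, q, hp, hq, rfl⟩
  exact Submodule.mem_iSup_of_mem ((p.length : ℤ) - q.length)
    (Submodule.subset_span ⟨a, b, c, p, q, hp, hq, rfl, rfl⟩)

/-- Every element is the sum of its homogeneous components. -/
theorem exists_components (x : LeavittPathAlgebra K E) :
    ∃ (s : Finset ℤ) (f : ℤ → LeavittPathAlgebra K E), (∀ n, f n ∈ component K E n) ∧
      x = ∑ n ∈ s, f n := by
  have hx : x ∈ ⨆ n, component K E n := iSup_component (K := K) (E := E) ▸ trivial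
  obtain ⟨f, hf, h⟩ := (Submodule.mem_iSup_iff_exists_finsupp _ _).1 hx
  exact ⟨f.support, f, hf, h.symm⟩

/-- Homogeneous elements of different degrees are linearly independent. -/
theorem eq_zero_of_sum_eq_zero {s : Finset ℤ} {f : ℤ → LeavittPathAlgebra K E}
    (hf : ∀ n, f n ∈ component K E n) (h : ∑ n ∈ s, f n = 0) : ∀ n ∈ s, f n = 0 := by
  intro n hn
  apply toUnital_injective K E
  have h1 : proj K E n (∑ m ∈ s, f m) = 0 := by rw [h, map_zero]
  rw [map_sum, Finset.sum_eq_single_of_mem n hn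
    fun m _ hm => proj_of_mem_of_ne (hf m) hm, proj_of_mem (hf n)] at h1
  rw [h1, map_zero]

theorem mem_component_iff {n : ℤ} {x : LeavittPathAlgebra K E} :
    x ∈ component K E n ↔ degHom K E x = .single n (toUnital K E x) := by
  refine ⟨degHom_of_mem, fun h => ?_⟩
  obtain ⟨s, f, hf, rfl⟩ := exists_components x
  refine Submodule.sum_mem _ fun m hm => ?_
  by_cases hmn : m = n
  · exact hmn ▸ hf m
  · have h1 : f m = 0 := by
      apply toUnital_injective K E
      have h2 : proj K E m (∑ m ∈ s, f m) = 0 := by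
        change (degHom K E _).coeff m = 0
        rw [h, AddMonoidAlgebra.coeff_single, Finsupp.single_eq_of_ne hmn]
      rw [map_sum, Finset.sum_eq_single_of_mem m hm
        fun k _ hk => proj_of_mem_of_ne (hf k) hk, proj_of_mem (hf m)] at h2
      rw [h2, map_zero]
    rw [h1]; exact zero_mem _

theorem mul_mem_component {m n : ℤ} {x y : LeavittPathAlgebra K E} (hx : x ∈ component K E m)
    (hy : y ∈ component K E n) : x * y ∈ component K E (m + n) := by
  rw [mem_component_iff] at *
  rw [map_mul, hx, hy, AddMonoidAlgebra.single_mul_single, ← map_mul]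

theorem vertex_mem (a : V) : vertex K E a ∈ component K E 0 :=
  mem_component_iff.2 (degHom_vertex a)

theorem edge_mem (e : A) : edge K E e ∈ component K E 1 :=
  mem_component_iff.2 (degHom_edge e)

theorem ghost_mem (e : A) : ghost K E e ∈ component K E (-1) :=
  mem_component_iff.2 (degHom_ghost e)

theorem real_mem (a : V) (p : List A) : real K E a p ∈ component K E p.length :=
  mem_component_iff.2 (degHom_real a p)

theorem ghostPath_mem (a : V) (p : List A) : ghostPath K E a p ∈ component K E (-p.length) :=
  mem_component_iff.2 (degHom_ghostPath a p)

/-- A homomorphism respects degrees as soon as it does so on the generators. -/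
theorem map_mem_component {V' A' : Type*} {F : DirectedGraph V' A'}
    (φ : LeavittPathAlgebra K F →ₙₐ[K] LeavittPathAlgebra K E)
    (hv : ∀ a, φ (vertex K F a) ∈ component K E 0) (he : ∀ e, φ (edge K F e) ∈ component K E 1)
    (hg : ∀ e, φ (ghost K F e) ∈ component K E (-1)) {n : ℤ} {x : LeavittPathAlgebra K F}
    (hx : x ∈ component K F n) : φ x ∈ component K E n := by
  have h1 : ∀ p a, φ (real K F a p) ∈ component K E p.length := by
    intro p
    induction p with
    | nil => exact hv
    | cons e p ih =>
      intro a
      rw [real, map_mul, List.length_cons, Nat.cast_succ, add_comm]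
      exact mul_mem_component (he e) (ih _)
  have h2 : ∀ p a, φ (ghostPath K F a p) ∈ component K E (-p.length) := by
    intro p
    induction p with
    | nil => exact hv
    | cons e p ih =>
      intro a
      rw [ghostPath, map_mul, List.length_cons, Nat.cast_succ, neg_add]
      exact mul_mem_component (ih _) (hg e)
  induction hx using Submodule.span_induction with
  | mem x h =>
    obtain ⟨a, b, c, p, q, -, -, hn, rfl⟩ := h
    rw [map_mul, ← hn, sub_eq_add_neg]
    exact mul_mem_component (h1 p a) (h2 q b)
  | zero => rw [map_zero]; exact zero_mem _
  | add x y _ _ h1 h2 => rw [map_add]; exact add_mem h1 h2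
  | smul r x _ h => rw [map_smul]; exact Submodule.smul_mem _ r h

/-! ### Vertices are nonzero -/

/-- Branching data: over every vertex which emits an edge, the infinite set `A ⊕ ℕ` is a disjoint
union of copies of itself, one for each emitted edge. The map `enc e` embeds the copy of `e`, and
`dec a` finds the copy and the preimage of a point over `a`. -/
theorem exists_branching (E : DirectedGraph V A) :
    ∃ (enc : A → A ⊕ ℕ → A ⊕ ℕ) (dec : V → A ⊕ ℕ → Option A × (A ⊕ ℕ)),
      (∀ e z, dec (E.s e) (enc e z) = (some e, z)) ∧
      ∀ a, (∃ e, E.s e = a) → ∀ z, ∃ e, E.s e = a ∧ (dec a z).1 = some e ∧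
        enc e (dec a z).2 = z := by
  have key : ∀ a, (∃ e, E.s e = a) → Nonempty ({e // E.s e = a} × (A ⊕ ℕ) ≃ (A ⊕ ℕ)) := by
    intro a ha
    have : Nonempty {e // E.s e = a} := nonempty_subtype.2 ha
    refine Cardinal.eq.1 ?_
    rw [Cardinal.mk_prod, Cardinal.lift_id, Cardinal.lift_id]
    refine Cardinal.mul_eq_right (Cardinal.aleph0_le_mk _) ?_ (Cardinal.mk_ne_zero _)
    exact Cardinal.mk_le_of_injective (f := fun e : {e // E.s e = a} => (Sum.inl e.1 : A ⊕ ℕ))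
      fun e f h => Subtype.ext (Sum.inl_injective h)
  have φ := fun a (ha : ∃ e, E.s e = a) => (key a ha).some
  classical
  refine ⟨fun e z => φ _ ⟨e, rfl⟩ (⟨e, rfl⟩, z), fun a z => if ha : ∃ e, E.s e = a then
    (some ((φ a ha).symm z).1.1, ((φ a ha).symm z).2) else (none, z), fun e z => ?_,
    fun a ha z => ?_⟩
  · dsimp only
    rw [dif_pos ⟨e, rfl⟩, Equiv.symm_apply_apply]
  · simp only [dif_pos ha]
    generalize hy : (φ a ha).symm z = y
    obtain ⟨⟨e, rfl⟩, z'⟩ := y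
    exact ⟨e, rfl, rfl, by rw [← hy, Equiv.apply_symm_apply]⟩

/-- The vertices are nonzero: with branching data, `L_K(E)` acts on the functions on
`V × (A ⊕ ℕ)`, and a vertex `a` acts by restriction to the nonempty set of points over `a`. -/
theorem vertex_ne_zero (a : V) : vertex K E a ≠ 0 := by
  classical
  obtain ⟨enc, dec, h1, h2⟩ := exists_branching E
  let fv : V → Module.End K (V → A ⊕ ℕ → K) := fun a =>
    { toFun := fun f x z => if x = a then f x z else 0
      map_add' := fun f g => by ext x z; simp only [Pi.add_apply]; split_ifs <;> simp
      map_smul' := fun r f => by ext x z; simp }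
  let fe : A → Module.End K (V → A ⊕ ℕ → K) := fun e =>
    { toFun := fun f x z => if x = E.s e ∧ (dec x z).1 = some e then f (E.r e) (dec x z).2 else 0
      map_add' := fun f g => by ext x z; simp only [Pi.add_apply]; split_ifs <;> simp
      map_smul' := fun r f => by ext x z; simp }
  let fg : A → Module.End K (V → A ⊕ ℕ → K) := fun e =>
    { toFun := fun f x z => if x = E.r e then f (E.s e) (enc e z) else 0
      map_add' := fun f g => by ext x z; simp only [Pi.add_apply]; split_ifs <;> simp
      map_smul' := fun r f => by ext x z; simp }
  have hfv : ∀ a f x z, fv a f x z = if x = a then f x z else 0 := fun _ _ _ _ => rfl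
  have hfe : ∀ e f x z, fe e f x z =
      if x = E.s e ∧ (dec x z).1 = some e then f (E.r e) (dec x z).2 else 0 := fun _ _ _ _ => rfl
  have hfg : ∀ e f x z, fg e f x z = if x = E.r e then f (E.s e) (enc e z) else 0 :=
    fun _ _ _ _ => rfl
  let φ : LeavittFamily E (Module.End K (V → A ⊕ ℕ → K)) :=
    { vertex := fv
      edge := fe
      ghost := fg
      vertex_idem := fun a => by
        ext f x z; simp only [Module.End.mul_apply, hfv]; split_ifs <;> rfl
      vertex_orth := fun a b h => by
        ext f x z; simp only [Module.End.mul_apply, hfv]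
        split_ifs with h3 h4
        · exact absurd (h3.symm.trans h4) h
        all_goals rfl
      source_edge := fun e => by
        ext f x z; simp only [Module.End.mul_apply, hfv, hfe]; split_ifs <;> simp_all
      edge_range := fun e => by
        ext f x z; simp only [Module.End.mul_apply, hfv, hfe]; split_ifs <;> simp_all
      range_ghost := fun e => by
        ext f x z; simp only [Module.End.mul_apply, hfv, hfg]; split_ifs <;> simp_all
      ghost_source := fun e => by
        ext f x z; simp only [Module.End.mul_apply, hfv, hfg]; split_ifs <;> simp_all
      ck1_same := fun e => by
        ext f x z; simp only [Module.End.mul_apply, hfv, hfg, hfe, h1]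
        split_ifs <;> simp_all
      ck1_ne := fun e e' h => by
        ext f x z; simp only [Module.End.mul_apply, hfg, hfe]
        split_ifs with h3 h4
        · rw [h1] at h4
          exact absurd (Option.some_injective _ h4.2) h
        all_goals rfl
      ck2 := fun a hne hfin => by
        ext f x z
        simp only [LinearMap.sum_apply, Finset.sum_apply, Module.End.mul_apply, hfv, hfe, hfg]
        by_cases hx : x = a
        · subst hx
          obtain ⟨e, he, h3, h4⟩ := h2 x hne z
          rw [Finset.sum_eq_single_of_mem e (hfin.mem_toFinset.2 he) fun e' _ h => ?_]
          · simp [he, h3, h4]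
          · rw [if_neg]
            rintro ⟨-, h5⟩
            exact h (Option.some_injective _ (h5.symm.trans h3))
        · rw [if_neg hx, Finset.sum_eq_zero]
          intro e he
          rw [if_neg]
          rintro ⟨h5, -⟩
          exact hx (h5.trans (hfin.mem_toFinset.1 he)) }
  intro h
  have h3 : φ.lift K (vertex K E a) = fv a := φ.lift_vertex a
  rw [h, map_zero] at h3
  have h4 := congrFun (congrFun (LinearMap.congr_fun h3 (fun _ _ => 1)) a) (.inr 0)
  simp [hfv] at h4

end LeavittPathAlgebra

/-! ### Direct finiteness -/

namespace LeavittPathAlgebra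

variable {K : Type w} [Field K] {V : Type u} {A : Type v} {E : DirectedGraph V A}

theorem real_ne_zero {a c : V} {p : List A} (h : E.IsPath a p c) : real K E a p ≠ 0 := by
  intro h0
  have h1 := ghostPath_mul_real_self (K := K) h
  rw [h0, mul_zero] at h1
  exact vertex_ne_zero c h1.symm

/-- A closed path `α` with an exit satisfies `α* α = v` but not `α α* = v`: if `α = β e γ` and `f`
is an exit at `e`, then `α α* β f = 0`, whereas `β f` is nonzero. -/
theorem noCycleHasExit_of_isGradedDirectlyFinite
    (h : IsGradedDirectlyFinite (component K E) (Set.range (vertex K E))) :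
    E.NoCycleHasExit := by
  rintro p ⟨-, ⟨a, hp⟩, -⟩ ⟨f, e, he, hs, hne⟩
  have h1 : real K E a p * ghostPath K E a p = vertex K E a :=
    h (vertex K E a) ⟨a, rfl⟩ (ghostPath K E a p) (real K E a p) ⟨_, ghostPath_mem a p⟩
      ⟨_, real_mem a p⟩ (vertex_mul_ghostPath hp) (ghostPath_mul_vertex hp) (vertex_mul_real hp)
      (real_mul_vertex hp) (ghostPath_mul_real_self hp)
  obtain ⟨p₁, p₂, rfl⟩ := List.append_of_mem he
  obtain ⟨b, hb1, hb2⟩ := hp.exists_of_append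
  have hf : E.IsPath b [f] (E.r f) := ⟨hs.trans hb2.1, rfl⟩
  have hpf := DirectedGraph.isPath_append hb1 hf
  apply real_ne_zero (K := K) hpf
  rw [← vertex_mul_real hpf, ← h1, real_append hb1 hf, mul_assoc, ghostPath_append hb1 hb2,
    mul_assoc, ← mul_assoc (ghostPath K E a p₁), ghostPath_mul_real_self hb1,
    vertex_mul_real hf, real, ghostPath, mul_assoc, ← mul_assoc (ghost K E e),
    ghost_mul_edge_of_ne hne.symm, zero_mul, mul_zero, mul_zero]

theorem isGradedDirectlyFinite_of_isDirectlyFinite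
    (h : IsDirectlyFinite (LeavittPathAlgebra K E)) :
    IsGradedDirectlyFinite (component K E) (Set.range (vertex K E)) := by
  rintro _ ⟨a, rfl⟩ x y _ _ h1 h2 h3 h4 h5
  exact h x y _ (vertex_mul_self a) h1 h2 h3 h4 h5

end LeavittPathAlgebra

/-- In a ring with identity in which one-sided inverses are two-sided, the corners inherit this
property: add `1 - e` to elements of `eRe`. -/
theorem isDirectlyFinite_of_isDedekindFinite {R : Type*} [Ring R]
    (h : ∀ x y : R, x * y = 1 → y * x = 1) : IsDirectlyFinite R := by
  intro x y e he hx1 hx2 hy1 hy2 hxy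
  have h1 : (x + (1 - e)) * (y + (1 - e)) = 1 := by
    have : (x + (1 - e)) * (y + (1 - e)) =
      x * y + (x - x * e) + (y - e * y) + (1 - e - e + e * e) := by noncomm_ring
    rw [this, he, hx2, hy1, hxy]; abel
  have h2 := h _ _ h1
  have : (y + (1 - e)) * (x + (1 - e)) =
      y * x + (y - y * e) + (x - e * x) + (1 - e - e + e * e) := by noncomm_ring
  rw [this, he, hx1, hy2] at h2
  calc y * x = (y * x + (y - y) + (x - x) + (1 - e - e + e)) - (1 - e) := by abel
    _ = e := by rw [h2]; abel

theorem MatrixSumShape.isDirectlyFinite (K : Type*) [Field K] (D : MatrixSumShape) :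
    IsDirectlyFinite (D.Carrier K) := by
  refine isDirectlyFinite_of_isDedekindFinite fun x y h => Prod.ext (funext fun i => ?_)
    (funext fun j => ?_)
  · exact mul_eq_one_comm.1 (congrFun (congrArg Prod.fst h) i)
  · exact mul_eq_one_comm.1 (congrFun (congrArg Prod.snd h) j)

theorem isDirectlyFinite_of_isDirectedUnionOfGraded {K : Type*} [Field K] {R : Type*}
    [NonUnitalRing R] [Module K R] (𝒜 : ℤ → Submodule K R)
    (h : IsDirectedUnionOfGraded 𝒜 fun B => IsGradedMatrixSum (inducedGrading 𝒜 B)) :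
    IsDirectlyFinite R := by
  obtain ⟨𝒮, hdir, hcov, hP⟩ := h
  intro x y e he hx1 hx2 hy1 hy2 hxy
  obtain ⟨Bx, hBx, hx⟩ := hcov x
  obtain ⟨By, hBy, hy⟩ := hcov y
  obtain ⟨B, hB, h1, h2⟩ := hdir Bx hBx By hBy
  have hxB : x ∈ B := h1 hx
  have hyB : y ∈ B := h2 hy
  have heB : e ∈ B := hxy ▸ mul_mem hxB hyB
  obtain ⟨-, D, φ, ⟨hinj, -⟩, -⟩ := hP B hB
  have key := D.isDirectlyFinite K (φ ⟨x, hxB⟩) (φ ⟨y, hyB⟩) (φ ⟨e, heB⟩)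
  simp only [← map_mul, hinj.eq_iff, MulMemClass.mk_mul_mk, Subtype.mk.injEq] at key
  exact key he hx1 hx2 hy1 hy2 hxy

/-! ### Finite graphs in which no cycle has an exit -/

namespace DirectedGraph

variable {V : Type u} {A : Type v} {E : DirectedGraph V A}

theorem IsPath.exists_shorter_closed {a b : V} {p : List A} (hp : E.IsPath a p b)
    (hd : ¬ (p.map E.s).Nodup) :
    ∃ c q, E.IsPath c q c ∧ q ≠ [] ∧ q.length < p.length ∧ q ⊆ p := by
  induction p generalizing a with
  | nil => exact absurd List.nodup_nil hd
  | cons e p ih =>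
    by_cases he : E.s e ∈ p.map E.s
    · obtain ⟨f, hf, hs⟩ := List.mem_map.1 he
      obtain ⟨p₁, p₂, rfl⟩ := List.append_of_mem hf
      obtain ⟨c, h1, h2⟩ := hp.2.exists_of_append
      have hc : c = E.s e := h2.1.symm.trans hs
      subst hc
      refine ⟨E.s e, e :: p₁, ⟨rfl, h1⟩, by simp, by simp, ?_⟩
      exact List.cons_subset_cons e (List.subset_append_left _ _)
    · have hd' : ¬ (p.map E.s).Nodup := fun h => hd (by
        rw [List.map_cons]; exact List.nodup_cons.2 ⟨he, h⟩)
      obtain ⟨c, q, h1, h2, h3, h4⟩ := ih hp.2 hd'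
      exact ⟨c, q, h1, h2, h3.trans (Nat.lt_succ_self _), fun _ h => List.mem_cons_of_mem _ (h4 h)⟩

/-- A closed path of positive length contains a cycle. -/
theorem IsPath.exists_cycle {a : V} {p : List A} (hp : E.IsPath a p a) (hne : p ≠ []) :
    ∃ c, E.IsCycle c ∧ c ⊆ p := by
  induction hn : p.length using Nat.strong_induction_on generalizing a p with
  | _ n ih =>
    by_cases hd : (p.map E.s).Nodup
    · exact ⟨p, ⟨hne, ⟨a, hp⟩, hd⟩, List.Subset.refl p⟩
    · obtain ⟨c, q, h1, h2, h3, h4⟩ := hp.exists_shorter_closed hd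
      obtain ⟨z, h5, h6⟩ := ih q.length (hn ▸ h3) h1 h2 rfl
      exact ⟨z, h5, fun _ h => h4 (h6 h)⟩

variable (E) in
/-- A set of vertices which contains all sinks and meets every cycle. In a finite graph no path
can avoid such a set forever. -/
def IsTerminal (W : Set V) : Prop :=
  (∀ a, (∀ e, E.s e ≠ a) → a ∈ W) ∧ ∀ p, E.IsCycle p → ∃ e ∈ p, E.s e ∈ W

variable (E) in
/-- The path `p` from `a` ends in `b` and has no edge which starts in `W`. If `b ∈ W`, this says
that `p` is stopped at its first visit to `W`. -/
def IsStopped (W : Set V) (a : V) (p : List A) (b : V) : Prop :=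
  E.IsPath a p b ∧ ∀ e ∈ p, E.s e ∉ W

theorem IsTerminal.wellFounded [Finite V] {W : Set V} (hW : E.IsTerminal W) :
    WellFounded fun b a : V => a ∉ W ∧ ∃ e, E.s e = a ∧ E.r e = b := by
  set R : V → V → Prop := fun b a : V => a ∉ W ∧ ∃ e, E.s e = a ∧ E.r e = b with hR
  have key : ∀ b a, Relation.TransGen R b a → ∃ p, p ≠ [] ∧ E.IsStopped W a p b := by
    intro b a h
    induction h with
    | single h =>
      obtain ⟨h1, e, rfl, rfl⟩ := h
      exact ⟨[e], by simp, ⟨rfl, rfl⟩, by simpa using h1⟩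
    | tail _ h ih =>
      obtain ⟨h1, e, rfl, rfl⟩ := h
      obtain ⟨p, -, h2, h3⟩ := ih
      refine ⟨e :: p, by simp, ⟨rfl, h2⟩, ?_⟩
      intro f hf
      rcases List.mem_cons.1 hf with rfl | hf
      exacts [h1, h3 f hf]
  have hirr : Std.Irrefl (Relation.TransGen R) := ⟨fun a ha => by
    obtain ⟨p, hne, hp, hoff⟩ := key a a ha
    obtain ⟨c, hc, hcp⟩ := hp.exists_cycle hne
    obtain ⟨e, he, heW⟩ := hW.2 c hc
    exact hoff e (hcp he) heW⟩
  have hwf : WellFounded (Relation.TransGen R) := Finite.wellFounded_of_trans_of_irrefl _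
  exact Subrelation.wf (fun h => Relation.TransGen.single h) hwf

/-- A minimal terminal set consists of the sinks and of one vertex on each cycle. If no cycle has
an exit, the cycle through such a vertex is the only way to go on from it. -/
theorem NoCycleHasExit.exists_isTerminal [Finite V] (hE : E.NoCycleHasExit) :
    ∃ W, E.IsTerminal W ∧ ∀ w ∈ W, (∃ e, E.s e = w) → ∃ e q, E.s e = w ∧
      E.IsStopped W (E.r e) q w ∧ ∀ f ∈ e :: q, ∀ g, E.s g = E.s f → g = f := by
  have huniv : E.IsTerminal Set.univ :=
    ⟨fun _ _ => trivial, fun p hp => ⟨p.head hp.1, List.head_mem _, trivial⟩⟩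
  obtain ⟨W, hW, hmin⟩ := exists_minimal_of_wellFoundedLT E.IsTerminal ⟨_, huniv⟩
  refine ⟨W, hW, ?_⟩
  rintro w hw ⟨e₀, he₀⟩
  have hnot : ¬ E.IsTerminal (W \ {w}) := fun h =>
    ((hmin h Set.sdiff_subset) hw).2 rfl
  have hsink : ∀ a, (∀ e, E.s e ≠ a) → a ∈ W \ {w} := fun a ha =>
    ⟨hW.1 a ha, fun h => ha e₀ (he₀.trans h.symm)⟩
  have : ∃ p, E.IsCycle p ∧ ∀ e ∈ p, E.s e ∉ W \ {w} := by
    by_contra! h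
    exact hnot ⟨hsink, h⟩
  obtain ⟨p, hp, hoff⟩ := this
  obtain ⟨e, he, heW⟩ := hW.2 p hp
  have hew : E.s e = w := by
    by_contra h
    exact hoff e he ⟨heW, h⟩
  have hforced : ∀ f ∈ p, ∀ g, E.s g = E.s f → g = f := fun f hf g hg => by
    by_contra hne
    exact hE p hp ⟨g, f, hf, hg, hne⟩
  obtain ⟨-, ⟨a, hpa⟩, hnd⟩ := hp
  obtain ⟨p₁, p₂, rfl⟩ := List.append_of_mem he
  obtain ⟨b, h1, h2⟩ := hpa.exists_of_append
  have hb : b = w := h2.1.symm.trans hew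
  subst hb
  have hq : ∀ f ∈ p₂ ++ p₁, f ∈ p₁ ++ e :: p₂ := fun f hf => by
    simp only [List.mem_append, List.mem_cons] at hf ⊢; tauto
  refine ⟨e, p₂ ++ p₁, hew, ⟨isPath_append h2.2 h1, fun f hf hfW => ?_⟩, fun f hf => ?_⟩
  · have hfw : E.s f = b := by
      by_contra h
      exact hoff f (hq f hf) ⟨hfW, h⟩
    rw [List.map_append, List.map_cons, List.nodup_middle, ← List.map_append] at hnd
    refine (List.nodup_cons.1 hnd).1 (List.mem_map.2 ⟨f, ?_, hfw.trans hew.symm⟩)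
    simp only [List.mem_append] at hf ⊢; tauto
  · rcases List.mem_cons.1 hf with rfl | hf
    exacts [hforced _ he, hforced _ (hq f hf)]

end DirectedGraph

namespace LeavittPathAlgebra

variable {K : Type w} [Field K] {V : Type u} {A : Type v} {E : DirectedGraph V A}

open DirectedGraph

/-- Paths which stop at their first visit to `W` are orthonormal: none is a proper beginning of
another one. -/
theorem ghostPath_mul_real [DecidableEq V] [DecidableEq A] {W : Set V} {a b c d : V}
    {p q : List A} (hc : c ∈ W) (hd : d ∈ W) (hp : E.IsStopped W a p c)
    (hq : E.IsStopped W b q d) :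
    ghostPath K E a p * real K E b q = if (a, p) = (b, q) then vertex K E c else 0 := by
  by_cases hab : a = b
  · subst hab
    induction p generalizing a q with
    | nil =>
      obtain ⟨h1, -⟩ := hp
      cases q with
      | nil => rw [if_pos rfl]; cases h1; exact vertex_mul_self _
      | cons f q =>
        have h2 : a = c := h1
        exact absurd (hq.1.1.trans h2 ▸ hc) (hq.2 f (by simp))
    | cons e p ih =>
      cases q with
      | nil =>
        have h2 : a = d := hq.1
        exact absurd (hp.1.1.trans h2 ▸ hd) (hp.2 e (by simp))
      | cons f q =>
        rw [ghostPath, real, mul_assoc, ← mul_assoc (ghost K E e)]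
        by_cases hef : e = f
        · subst hef
          rw [ghost_mul_edge_self, vertex_mul_real hq.1.2,
            ih ⟨hp.1.2, fun g hg => hp.2 g (by simp [hg])⟩
              ⟨hq.1.2, fun g hg => hq.2 g (by simp [hg])⟩]
          simp
        · rw [ghost_mul_edge_of_ne hef, zero_mul, mul_zero, if_neg]
          simp [hef]
  · rw [if_neg fun h => hab (congrArg Prod.fst h), ← ghostPath_mul_vertex hp.1, mul_assoc,
      vertex_mul_real_of_ne hq.1 hab, mul_zero]

/-- From every vertex there are finitely many paths which stop at their first visit to a terminal
set, and the vertex is the sum of the idempotents `p p*` which belong to these paths. -/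
theorem exists_vertex_eq_sum [Finite V] [Finite A] {W : Set V} (hW : E.IsTerminal W) (a : V) :
    ∃ S : Finset (List A), (∀ p, p ∈ S ↔ ∃ w ∈ W, E.IsStopped W a p w) ∧
      vertex K E a = ∑ p ∈ S, real K E a p * ghostPath K E a p := by
  classical
  induction a using hW.wellFounded.induction with
  | _ a ih =>
  by_cases ha : a ∈ W
  · refine ⟨{[]}, fun p => ⟨fun h => ?_, fun h => ?_⟩, ?_⟩
    · rw [Finset.mem_singleton] at h
      subst h
      exact ⟨a, ha, rfl, by simp⟩
    · obtain ⟨w, hw, hp⟩ := h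
      cases p with
      | nil => simp
      | cons e p => exact absurd (hp.1.1 ▸ ha) (hp.2 e (by simp))
    · rw [Finset.sum_singleton, real, ghostPath, vertex_mul_self]
  · choose! S hS using ih
    have hfin : {e : A | E.s e = a}.Finite := Set.toFinite _
    have hne : {e : A | E.s e = a}.Nonempty := by
      by_contra h
      exact ha (hW.1 a fun e he => h ⟨e, he⟩)
    refine ⟨hfin.toFinset.biUnion fun e => (S (E.r e)).image (List.cons e), fun p => ?_, ?_⟩
    · simp only [Finset.mem_biUnion, Set.Finite.mem_toFinset, Finset.mem_image]
      constructor
      · rintro ⟨e, he, p, hp, rfl⟩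
        obtain ⟨w, hw, h1, h2⟩ := ((hS (E.r e) ⟨ha, e, he, rfl⟩).1 p).1 hp
        refine ⟨w, hw, ⟨he, h1⟩, fun f hf => ?_⟩
        rcases List.mem_cons.1 hf with rfl | hf
        · have he : E.s f = a := he
          rw [he]; exact ha
        · exact h2 f hf
      · rintro ⟨w, hw, h1, h2⟩
        cases p with
        | nil => exact absurd (show a = w from h1) (fun h => ha (h ▸ hw))
        | cons e p =>
          exact ⟨e, h1.1, p, ((hS (E.r e) ⟨ha, e, h1.1, rfl⟩).1 p).2
            ⟨w, hw, h1.2, fun f hf => h2 f (by simp [hf])⟩, rfl⟩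
    · rw [Finset.sum_biUnion, vertex_eq_sum a hne hfin]
      · refine Finset.sum_congr rfl fun e he => ?_
        have he : E.s e = a := hfin.mem_toFinset.1 he
        rw [Finset.sum_image fun p _ q _ h => (List.cons.inj h).2]
        conv_lhs => rw [← edge_mul_vertex, (hS (E.r e) ⟨ha, e, he, rfl⟩).2]
        rw [Finset.mul_sum, Finset.sum_mul]
        simp only [real, ghostPath, mul_assoc]
      · intro e _ f _ hef
        refine Finset.disjoint_left.2 fun p h1 h2 => hef ?_
        obtain ⟨p₁, -, rfl⟩ := Finset.mem_image.1 h1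
        obtain ⟨p₂, -, h3⟩ := Finset.mem_image.1 h2
        exact (List.cons.inj h3).1.symm

/-- If a path takes the only edge out of each of its vertices, then `p p*` is a vertex. -/
theorem real_mul_ghostPath_of_forced {a b : V} {p : List A} (hp : E.IsPath a p b)
    (hf : ∀ f ∈ p, ∀ g, E.s g = E.s f → g = f) :
    real K E a p * ghostPath K E a p = vertex K E a := by
  induction p generalizing a with
  | nil => exact vertex_mul_self a
  | cons e p ih =>
    have hset : {g : A | E.s g = a} = {e} := Set.ext fun g =>
      ⟨fun h => hf e (by simp) g (Eq.trans h hp.1.symm), fun h => by rw [h]; exact hp.1⟩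
    have hfin : {g : A | E.s g = a}.Finite := hset ▸ Set.finite_singleton e
    have hto : hfin.toFinset = {e} := by
      ext g; rw [Set.Finite.mem_toFinset, hset]; simp
    rw [vertex_eq_sum a (hset ▸ Set.singleton_nonempty e) hfin, hto, Finset.sum_singleton, real,
      ghostPath, mul_assoc, ← mul_assoc (real K E _ p),
      ih hp.2 fun f h => hf f (by simp [h]), vertex_mul_ghost]

end LeavittPathAlgebra

/-! ### Sums of matrix rings inside an algebra -/

section MatrixHom

variable {K : Type*} [Field K] {L : Type*} [NonUnitalRing L] [Module K L] [IsScalarTower K L L]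
  [SMulCommClass K L L]

/-- The homomorphism `M ↦ ∑ xᵢ ρ(Mᵢⱼ) yⱼ` from a matrix ring, for elements with
`yᵢ xⱼ = δᵢⱼ ρ(1)`. -/
def matrixHom {R ι : Type*} [Ring R] [Algebra K R] [Fintype ι] [DecidableEq ι]
    (ρ : R →ₙₐ[K] L) (x y : ι → L) (h : ∀ i j, y i * x j = if i = j then ρ 1 else 0) :
    Matrix ι ι R →ₙₐ[K] L where
  toFun M := ∑ i, ∑ j, x i * ρ (M i j) * y j
  map_smul' r M := by
    simp only [Matrix.smul_apply, map_smul, mul_smul_comm, smul_mul_assoc, Finset.smul_sum,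
      MonoidHom.id_apply]
  map_zero' := by simp
  map_add' M N := by
    simp only [Matrix.add_apply, map_add, mul_add, add_mul, Finset.sum_add_distrib]
  map_mul' M N := by
    have key : ∀ i j k l, x i * ρ (M i j) * y j * (x k * ρ (N k l) * y l) =
        if j = k then x i * ρ (M i j * N k l) * y l else 0 := by
      intro i j k l
      have : x i * ρ (M i j) * y j * (x k * ρ (N k l) * y l) =
        x i * (ρ (M i j) * (y j * x k) * ρ (N k l)) * y l := by simp only [mul_assoc]
      rw [this, h]
      split_ifs
      · rw [← map_mul, mul_one, ← map_mul]
      · simp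
    simp only [Finset.sum_mul, Finset.mul_sum, key, Matrix.mul_apply, map_sum]
    simp only [Finset.sum_ite_eq', Finset.mem_univ, if_true]
    rw [Finset.sum_congr rfl fun i _ => Finset.sum_comm, Finset.sum_comm (γ := ι)]
    refine Finset.sum_congr rfl fun i _ => Finset.sum_comm

theorem matrixHom_apply {R ι : Type*} [Ring R] [Algebra K R] [Fintype ι] [DecidableEq ι]
    (ρ : R →ₙₐ[K] L) (x y : ι → L) (h : ∀ i j, y i * x j = if i = j then ρ 1 else 0)
    (M : Matrix ι ι R) : matrixHom ρ x y h M = ∑ i, ∑ j, x i * ρ (M i j) * y j := rfl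

theorem mul_matrixHom_mul {R ι : Type*} [Ring R] [Algebra K R] [Fintype ι] [DecidableEq ι]
    (ρ : R →ₙₐ[K] L) (x y : ι → L) (h : ∀ i j, y i * x j = if i = j then ρ 1 else 0)
    (M : Matrix ι ι R) (i j : ι) : y i * matrixHom ρ x y h M * x j = ρ (M i j) := by
  have key : ∀ k l, y i * (x k * ρ (M k l) * y l) * x j =
      if k = i then if l = j then ρ (M k l) else 0 else 0 := by
    intro k l
    have : y i * (x k * ρ (M k l) * y l) * x j = (y i * x k) * ρ (M k l) * (y l * x j) := by
      simp only [mul_assoc]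
    rw [this, h, h]
    by_cases hk : k = i <;> by_cases hl : l = j
    · rw [if_pos hk.symm, if_pos hl, if_pos hk, if_pos hl, ← map_mul, ← map_mul, one_mul, mul_one]
    all_goals simp [hk, hl, eq_comm (a := i)]
  rw [matrixHom_apply]
  simp only [Finset.mul_sum, Finset.sum_mul, key]
  simp

theorem matrixHom_single {R ι : Type*} [Ring R] [Algebra K R] [Fintype ι] [DecidableEq ι]
    (ρ : R →ₙₐ[K] L) (x y : ι → L) (h : ∀ i j, y i * x j = if i = j then ρ 1 else 0)
    (i j : ι) (r : R) : matrixHom ρ x y h (Matrix.single i j r) = x i * ρ r * y j := by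
  rw [matrixHom_apply, Finset.sum_eq_single i, Finset.sum_eq_single j]
  · simp
  · intro l _ hl; simp [Matrix.single_apply_of_col_ne _ _ hl.symm]
  · simp
  · intro k _ hk; exact Finset.sum_eq_zero fun l _ => by simp [hk.symm]
  · simp

/-- Homomorphisms with pairwise orthogonal images add up to a homomorphism from the product. -/
def piHom {κ : Type*} [Fintype κ] {R : κ → Type*} [∀ k, NonUnitalRing (R k)]
    [∀ k, Module K (R k)] (f : ∀ k, R k →ₙₐ[K] L)
    (h : ∀ k l, k ≠ l → ∀ x y, f k x * f l y = 0) : (∀ k, R k) →ₙₐ[K] L where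
  toFun x := ∑ k, f k (x k)
  map_smul' r x := by simp [Finset.smul_sum]
  map_zero' := by simp
  map_add' x y := by simp [Finset.sum_add_distrib]
  map_mul' x y := by
    classical
    rw [Finset.sum_mul_sum]
    refine Finset.sum_congr rfl fun k _ => ?_
    rw [Finset.sum_eq_single_of_mem k (Finset.mem_univ k) fun l _ hl => h k l hl.symm _ _,
      Pi.mul_apply, map_mul]

/-- Two homomorphisms with orthogonal images add up to a homomorphism from the product. -/
def prodHom {R S : Type*} [NonUnitalRing R] [Module K R] [NonUnitalRing S] [Module K S]
    (f : R →ₙₐ[K] L) (g : S →ₙₐ[K] L) (h : ∀ x y, f x * g y = 0) (h' : ∀ x y, g y * f x = 0) :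
    R × S →ₙₐ[K] L where
  toFun x := f x.1 + g x.2
  map_smul' r x := by simp
  map_zero' := by simp
  map_add' x y := by simp only [Prod.fst_add, Prod.snd_add, map_add]; abel
  map_mul' x y := by simp [add_mul, mul_add, h, h']

variable (K L) in
/-- The data which define a homomorphism from a finite sum of matrix rings to `L`: for every
summand a homomorphism from its ring of coefficients and elements `x`, `y` of `L` which play the
role of the first column and of the first row of matrix units. -/
structure MatrixSystem (D : MatrixSumShape) where
  ρ₁ : Fin D.a → K →ₙₐ[K] L
  ρ₂ : Fin D.b → K[T;T⁻¹] →ₙₐ[K] L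
  x₁ : ∀ i, Fin (D.n i) → L
  y₁ : ∀ i, Fin (D.n i) → L
  x₂ : ∀ j, Fin (D.m j) → L
  y₂ : ∀ j, Fin (D.m j) → L
  h₁ : ∀ i p q, y₁ i p * x₁ i q = if p = q then ρ₁ i 1 else 0
  h₂ : ∀ j p q, y₂ j p * x₂ j q = if p = q then ρ₂ j 1 else 0
  orth₁ : ∀ i i', i ≠ i' → ∀ p q, y₁ i p * x₁ i' q = 0
  orth₂ : ∀ j j', j ≠ j' → ∀ p q, y₂ j p * x₂ j' q = 0
  orth₁₂ : ∀ i j p q, y₁ i p * x₂ j q = 0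
  orth₂₁ : ∀ i j p q, y₂ j q * x₁ i p = 0

namespace MatrixSystem

variable {D : MatrixSumShape} (Φ : MatrixSystem K L D)

theorem mul_sum_eq_zero {ι κ : Type*} [Fintype ι] [Fintype κ] {x y : ι → L} {x' y' : κ → L}
    (h : ∀ i j, y i * x' j = 0) (f : ι → ι → L) (g : κ → κ → L) :
    (∑ i, ∑ j, x i * f i j * y j) * (∑ i, ∑ j, x' i * g i j * y' j) = 0 := by
  simp only [Finset.sum_mul, Finset.mul_sum]
  refine Finset.sum_eq_zero fun i _ => Finset.sum_eq_zero fun j _ => Finset.sum_eq_zero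
    fun k _ => Finset.sum_eq_zero fun l _ => ?_
  have : ∀ i j k l, x i * f i j * y j * (x' k * g k l * y' l) =
      x i * f i j * (y j * x' k) * g k l * y' l := fun i j k l => by simp only [mul_assoc]
  simp [this, h]

/-- The homomorphism from the summand with number `i` over `K`. -/
noncomputable def hom₁ (i : Fin D.a) : Matrix (Fin (D.n i)) (Fin (D.n i)) K →ₙₐ[K] L :=
  matrixHom (Φ.ρ₁ i) (Φ.x₁ i) (Φ.y₁ i) (Φ.h₁ i)

/-- The homomorphism from the summand with number `j` over the Laurent polynomials. -/
noncomputable def hom₂ (j : Fin D.b) : Matrix (Fin (D.m j)) (Fin (D.m j)) K[T;T⁻¹] →ₙₐ[K] L :=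
  matrixHom (Φ.ρ₂ j) (Φ.x₂ j) (Φ.y₂ j) (Φ.h₂ j)

/-- The homomorphism given by a matrix system. -/
noncomputable def hom : D.Carrier K →ₙₐ[K] L :=
  prodHom (piHom Φ.hom₁ fun i i' h _ _ => mul_sum_eq_zero (Φ.orth₁ i i' h) _ _)
    (piHom Φ.hom₂ fun j j' h _ _ => mul_sum_eq_zero (Φ.orth₂ j j' h) _ _)
    (fun x y => by
      change (∑ i, Φ.hom₁ i (x i)) * (∑ j, Φ.hom₂ j (y j)) = 0
      rw [Finset.sum_mul_sum]
      exact Finset.sum_eq_zero fun i _ => Finset.sum_eq_zero fun j _ =>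
        mul_sum_eq_zero (Φ.orth₁₂ i j) _ _)
    (fun x y => by
      change (∑ j, Φ.hom₂ j (y j)) * (∑ i, Φ.hom₁ i (x i)) = 0
      rw [Finset.sum_mul_sum]
      exact Finset.sum_eq_zero fun j _ => Finset.sum_eq_zero fun i _ =>
        mul_sum_eq_zero (fun p q => Φ.orth₂₁ i j q p) _ _)

theorem hom_apply (M : D.Carrier K) :
    Φ.hom M = ∑ i, Φ.hom₁ i (M.1 i) + ∑ j, Φ.hom₂ j (M.2 j) := rfl

theorem hom_single₁ (i : Fin D.a) (p q : Fin (D.n i)) (c : K) :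
    Φ.hom (Pi.single i (Matrix.single p q c), 0) = Φ.x₁ i p * Φ.ρ₁ i c * Φ.y₁ i q := by
  rw [hom_apply, Finset.sum_eq_single_of_mem i (Finset.mem_univ i)]
  · simp [hom₁, matrixHom_single]
  · intro k _ hk; simp [hk]

theorem hom_single₂ (j : Fin D.b) (p q : Fin (D.m j)) (c : K[T;T⁻¹]) :
    Φ.hom (0, Pi.single j (Matrix.single p q c)) = Φ.x₂ j p * Φ.ρ₂ j c * Φ.y₂ j q := by
  rw [hom_apply, add_comm, Finset.sum_eq_single_of_mem j (Finset.mem_univ j)]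
  · simp [hom₂, matrixHom_single]
  · intro k _ hk; simp [hk]

theorem mul_hom₁_eq_zero {z : L} {i : Fin D.a} (hz : ∀ p, z * Φ.x₁ i p = 0)
    (M : Matrix (Fin (D.n i)) (Fin (D.n i)) K) : z * Φ.hom₁ i M = 0 := by
  simp [hom₁, matrixHom_apply, Finset.mul_sum, ← mul_assoc, hz]

theorem mul_hom₂_eq_zero {z : L} {j : Fin D.b} (hz : ∀ p, z * Φ.x₂ j p = 0)
    (M : Matrix (Fin (D.m j)) (Fin (D.m j)) K[T;T⁻¹]) : z * Φ.hom₂ j M = 0 := by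
  simp [hom₂, matrixHom_apply, Finset.mul_sum, ← mul_assoc, hz]

theorem mul_hom_mul₁ (M : D.Carrier K) (i : Fin D.a) (p q : Fin (D.n i)) :
    Φ.y₁ i p * Φ.hom M * Φ.x₁ i q = Φ.ρ₁ i (M.1 i p q) := by
  rw [hom_apply, mul_add, Finset.mul_sum, Finset.mul_sum,
    Finset.sum_eq_single_of_mem i (Finset.mem_univ i)
      fun k _ hk => Φ.mul_hom₁_eq_zero (Φ.orth₁ i k hk.symm p) _,
    Finset.sum_eq_zero fun j _ => Φ.mul_hom₂_eq_zero (Φ.orth₁₂ i j p) _, add_zero]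
  exact mul_matrixHom_mul _ _ _ _ _ _ _

theorem mul_hom_mul₂ (M : D.Carrier K) (j : Fin D.b) (p q : Fin (D.m j)) :
    Φ.y₂ j p * Φ.hom M * Φ.x₂ j q = Φ.ρ₂ j (M.2 j p q) := by
  rw [hom_apply, mul_add, Finset.mul_sum, Finset.mul_sum,
    Finset.sum_eq_zero fun i _ => Φ.mul_hom₁_eq_zero (fun q => Φ.orth₂₁ i j q p) _,
    Finset.sum_eq_single_of_mem j (Finset.mem_univ j)
      fun k _ hk => Φ.mul_hom₂_eq_zero (Φ.orth₂ j k hk.symm p) _, zero_add]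
  exact mul_matrixHom_mul _ _ _ _ _ _ _

theorem hom_injective (h₁ : ∀ i, Function.Injective (Φ.ρ₁ i))
    (h₂ : ∀ j, Function.Injective (Φ.ρ₂ j)) : Function.Injective Φ.hom := by
  intro M N h
  refine Prod.ext (funext fun i => ?_) (funext fun j => ?_)
  · ext p q
    apply h₁ i
    rw [← mul_hom_mul₁, h, mul_hom_mul₁]
  · refine Matrix.ext fun p q => h₂ j ?_
    rw [← mul_hom_mul₂, h, mul_hom_mul₂]

/-- If `x`, `y` have the degrees prescribed by the shifts, then a matrix is homogeneous of degree
`d` if and only if its image is, as soon as this is true for the rings of coefficients. -/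
theorem mem_grading_iff (𝒜 : ℤ → Submodule K L)
    (hmul : ∀ {m n : ℤ} {x y : L}, x ∈ 𝒜 m → y ∈ 𝒜 n → x * y ∈ 𝒜 (m + n))
    (hx₁ : ∀ i p, Φ.x₁ i p ∈ 𝒜 (D.δ i p)) (hy₁ : ∀ i p, Φ.y₁ i p ∈ 𝒜 (-D.δ i p))
    (hx₂ : ∀ j p, Φ.x₂ j p ∈ 𝒜 (D.ε j p)) (hy₂ : ∀ j p, Φ.y₂ j p ∈ 𝒜 (-D.ε j p))
    (hρ₁ : ∀ i d c, c ∈ trivialGrading K d ↔ Φ.ρ₁ i c ∈ 𝒜 d)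
    (hρ₂ : ∀ j d f, f ∈ laurentGrading K (D.t j) d ↔ Φ.ρ₂ j f ∈ 𝒜 d)
    (d : ℤ) (M : D.Carrier K) : M ∈ D.grading K d ↔ Φ.hom M ∈ 𝒜 d := by
  constructor
  · rintro ⟨h1, h2⟩
    rw [hom_apply]
    refine add_mem (Submodule.sum_mem _ fun i _ => ?_) (Submodule.sum_mem _ fun j _ => ?_)
    · rw [hom₁, matrixHom_apply]
      refine Submodule.sum_mem _ fun p _ => Submodule.sum_mem _ fun q _ => ?_
      have := hmul (hmul (hx₁ i p) ((hρ₁ i _ _).1 (h1 i p q))) (hy₁ i q)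
      convert this using 2
      ring
    · rw [hom₂, matrixHom_apply]
      refine Submodule.sum_mem _ fun p _ => Submodule.sum_mem _ fun q _ => ?_
      have := hmul (hmul (hx₂ j p) ((hρ₂ j _ _).1 (h2 j p q))) (hy₂ j q)
      convert this using 2
      ring
  · intro h
    refine ⟨fun i p q => (hρ₁ i _ _).2 ?_, fun j p q => (hρ₂ j _ _).2 ?_⟩
    · rw [← mul_hom_mul₁]
      have := hmul (hmul (hy₁ i p) h) (hx₁ i q)
      convert this using 2
      ring
    · rw [← mul_hom_mul₂]
      have := hmul (hmul (hy₂ j p) h) (hx₂ j q)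
      convert this using 2
      ring

end MatrixSystem

end MatrixHom

/-! ### Laurent polynomials inside an algebra -/

section LaurentHom

variable {K : Type*} [Field K]

theorem mem_trivialGrading_iff {d : ℤ} {c : K} : c ∈ trivialGrading K d ↔ (c ≠ 0 → d = 0) :=
  Iff.rfl

theorem mem_laurentGrading_iff {t : ℕ} {d : ℤ} {f : K[T;T⁻¹]} :
    f ∈ laurentGrading K t d ↔ ∀ k, f.coeff k ≠ 0 → (t : ℤ) * k = d := by
  constructor
  · intro h
    induction h using Submodule.span_induction with
    | mem f h =>
      obtain ⟨m, hm, rfl⟩ := h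
      intro k hk
      rw [LaurentPolynomial.T_apply] at hk
      have hmk : m = k := by by_contra h; exact hk (if_neg h)
      exact hmk ▸ hm
    | zero => intro k hk; exact absurd rfl hk
    | add f g _ _ h1 h2 =>
      intro k hk
      by_cases h : f.coeff k = 0
      · refine h2 k fun h' => hk ?_
        rw [AddMonoidAlgebra.coeff_add, Finsupp.add_apply, h, h', add_zero]
      · exact h1 k h
    | smul r f _ h =>
      intro k hk
      refine h k fun h' => hk ?_
      rw [AddMonoidAlgebra.coeff_smul, Finsupp.smul_apply, h', smul_zero]
  · intro h
    rw [← AddMonoidAlgebra.sum_coeff_single f]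
    refine Submodule.sum_mem _ fun k hk => ?_
    have : (AddMonoidAlgebra.single k (f.coeff k) : K[T;T⁻¹]) =
        f.coeff k • LaurentPolynomial.T k := by
      rw [LaurentPolynomial.T, AddMonoidAlgebra.smul_single, smul_eq_mul, mul_one]
    rw [this]
    exact Submodule.smul_mem _ _ (Submodule.subset_span
      ⟨k, h k (Finsupp.mem_support_iff.1 hk), rfl⟩)

variable {L : Type*} [NonUnitalRing L] [Module K L] [IsScalarTower K L L] [SMulCommClass K L L]

variable (K) in
/-- The homomorphism `c ↦ c u` given by an idempotent `u`. -/
def scalarHom (u : L) (hu : u * u = u) : K →ₙₐ[K] L where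
  toFun c := c • u
  map_smul' r c := by simp [mul_smul]
  map_zero' := zero_smul K u
  map_add' c d := add_smul c d u
  map_mul' c d := by rw [smul_mul_smul_comm, hu]

variable (K) in
/-- The homomorphism `∑ cₖ Tᵏ ↦ ∑ cₖ g(k)` given by an additive family `g` of powers. -/
noncomputable def laurentHom (g : ℤ → L) (hg : ∀ m n, g (m + n) = g m * g n) :
    K[T;T⁻¹] →ₙₐ[K] L :=
  AddMonoidAlgebra.liftMagma K
    { toFun := fun m => g m.toAdd
      map_mul' := fun m n => hg m.toAdd n.toAdd }

theorem laurentHom_apply (g : ℤ → L) (hg : ∀ m n, g (m + n) = g m * g n) (f : K[T;T⁻¹]) :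
    laurentHom K g hg f = f.coeff.sum fun k c => c • g k := rfl

theorem laurentHom_single (g : ℤ → L) (hg : ∀ m n, g (m + n) = g m * g n) (k : ℤ) (c : K) :
    laurentHom K g hg (AddMonoidAlgebra.single k c) = c • g k := by
  rw [laurentHom_apply, AddMonoidAlgebra.coeff_single]
  exact Finsupp.sum_single_index (h := fun k c => c • g k) (zero_smul K _)

/-- The integral powers of an element which is invertible in the corner of an idempotent `u`. -/
theorem exists_corner_zpow {u c c' : L} (hu : u * u = u) (h1 : u * c = c) (h2 : c * u = c)
    (h3 : u * c' = c') (h4 : c' * u = c') (h5 : c * c' = u) (h6 : c' * c = u) :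
    ∃ g : ℤ → L, (∀ m n, g (m + n) = g m * g n) ∧ g 0 = u ∧ g 1 = c ∧ g (-1) = c' := by
  have hu' : IsIdempotentElem u := hu
  let U : (hu'.Corner)ˣ :=
    { val := ⟨c, (Subsemigroup.mem_corner_iff hu').2 ⟨h1, h2⟩⟩
      inv := ⟨c', (Subsemigroup.mem_corner_iff hu').2 ⟨h3, h4⟩⟩
      val_inv := Subtype.ext h5
      inv_val := Subtype.ext h6 }
  let val : (hu'.Corner)ˣ → L := fun z => (z : hu'.Corner).1
  exact ⟨fun k => val (U ^ k), fun m n => congrArg val (zpow_add U m n),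
    congrArg val (zpow_zero U), congrArg val (zpow_one U), congrArg val (zpow_neg_one U)⟩

end LaurentHom

namespace LeavittPathAlgebra

variable {K : Type w} [Field K] {V : Type u} {A : Type v} {E : DirectedGraph V A}

theorem smul_vertex_mem_iff {a : V} {d : ℤ} {c : K} :
    c ∈ trivialGrading K d ↔ c • vertex K E a ∈ component K E d := by
  rw [mem_trivialGrading_iff]
  constructor
  · intro h
    by_cases hc : c = 0
    · rw [hc, zero_smul]; exact zero_mem _
    · rw [h hc]; exact Submodule.smul_mem _ c (vertex_mem a)
  · intro h hc
    by_contra hd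
    have := eq_zero_of_mem_of_mem (Submodule.smul_mem _ c (vertex_mem (K := K) (E := E) a)) h
      (Ne.symm hd)
    exact (smul_ne_zero hc (vertex_ne_zero a)) this

theorem proj_laurentHom {g : ℤ → LeavittPathAlgebra K E} (hg : ∀ m n, g (m + n) = g m * g n)
    {t : ℕ} (ht : 0 < t) (hdeg : ∀ k, g k ∈ component K E (t * k)) (f : K[T;T⁻¹]) (k : ℤ) :
    proj K E (t * k) (laurentHom K g hg f) = toUnital K E (f.coeff k • g k) := by
  rw [laurentHom_apply, Finsupp.sum, map_sum, Finset.sum_eq_single k]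
  · exact proj_of_mem (Submodule.smul_mem _ _ (hdeg k))
  · intro m _ hm
    refine proj_of_mem_of_ne (Submodule.smul_mem _ _ (hdeg m)) fun h => hm ?_
    exact mul_left_cancel₀ (Nat.cast_ne_zero.2 ht.ne') h
  · intro hk
    rw [Finsupp.notMem_support_iff.1 hk, zero_smul, map_zero]

theorem laurentHom_injective {g : ℤ → LeavittPathAlgebra K E}
    (hg : ∀ m n, g (m + n) = g m * g n) {t : ℕ} (ht : 0 < t)
    (hdeg : ∀ k, g k ∈ component K E (t * k)) (hne : ∀ k, g k ≠ 0) :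
    Function.Injective (laurentHom K g hg) := by
  intro f f' h
  refine LaurentPolynomial.ext fun k => ?_
  have h1 := proj_laurentHom (K := K) hg ht hdeg f k
  rw [h, proj_laurentHom hg ht hdeg] at h1
  exact smul_left_injective K (hne k) (toUnital_injective K E h1.symm)

theorem laurentHom_mem_iff {g : ℤ → LeavittPathAlgebra K E}
    (hg : ∀ m n, g (m + n) = g m * g n) {t : ℕ} (ht : 0 < t)
    (hdeg : ∀ k, g k ∈ component K E (t * k)) (hne : ∀ k, g k ≠ 0) {d : ℤ} {f : K[T;T⁻¹]} :
    f ∈ laurentGrading K t d ↔ laurentHom K g hg f ∈ component K E d := by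
  rw [mem_laurentGrading_iff]
  constructor
  · intro h
    rw [laurentHom_apply]
    refine Submodule.sum_mem _ fun k hk => Submodule.smul_mem _ _ ?_
    exact h k (Finsupp.mem_support_iff.1 hk) ▸ hdeg k
  · intro h k hk
    by_contra hd
    have h1 := proj_laurentHom (K := K) hg ht hdeg f k
    rw [proj_of_mem_of_ne h (Ne.symm hd)] at h1
    exact smul_ne_zero hk (hne k) (toUnital_injective K E (h1.symm.trans (map_zero _).symm))

/-- The integral powers of a closed path `c` with `c c* = c* c`. -/
theorem exists_closed_path_zpow {a : V} {p : List A} (hp : E.IsPath a p a)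
    (h : real K E a p * ghostPath K E a p = vertex K E a) :
    ∃ g : ℤ → LeavittPathAlgebra K E, (∀ m n, g (m + n) = g m * g n) ∧ g 0 = vertex K E a ∧
      g 1 = real K E a p ∧ g (-1) = ghostPath K E a p ∧
      (∀ k, g k ∈ component K E (p.length * k)) ∧ ∀ k, g k ≠ 0 := by
  obtain ⟨g, hg, h0, h1, h2⟩ := exists_corner_zpow (vertex_mul_self a) (vertex_mul_real hp)
    (real_mul_vertex hp) (vertex_mul_ghostPath hp) (ghostPath_mul_vertex hp) h
    (ghostPath_mul_real_self hp)
  refine ⟨g, hg, h0, h1, h2, fun k => ?_, fun k hk => ?_⟩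
  · induction k using Int.induction_on with
    | zero => rw [h0, mul_zero]; exact vertex_mem a
    | succ k ih =>
      rw [hg, h1, mul_add, mul_one]
      exact mul_mem_component ih (real_mem a p)
    | pred k ih =>
      rw [sub_eq_add_neg, hg, h2, mul_add, mul_neg_one]
      exact mul_mem_component ih (ghostPath_mem a p)
  · apply vertex_ne_zero (K := K) (E := E) a
    rw [← h0, ← add_neg_cancel k, hg, hk, zero_mul]

end LeavittPathAlgebra

/-! ### The structure of `L_K(E)` for a finite graph in which no cycle has an exit -/

namespace DirectedGraph

variable {V : Type u} {A : Type v} {E : DirectedGraph V A}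

theorem IsPath.range_unique {a b c : V} {p : List A} (hb : E.IsPath a p b)
    (hc : E.IsPath a p c) : b = c := by
  induction p generalizing a with
  | nil => exact Eq.trans (Eq.symm hb) hc
  | cons e p ih => exact ih hb.2 hc.2

end DirectedGraph

namespace LeavittPathAlgebra

variable {K : Type w} [Field K] {V : Type u} {A : Type v} {E : DirectedGraph V A}

open DirectedGraph

/-- The structure theorem for finite graphs in which no cycle has an exit. For a vertex `w` of a
minimal terminal set `W`, the paths which are stopped at `w` index the matrix units of one summand.
The ring of coefficients is spanned by the powers of the cycle through `w`, if there is one. The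
last part says that every nonzero homogeneous element can be moved to a vertex in `W`. -/
theorem exists_matrixSystem [Finite V] [Finite A] (hE : E.NoCycleHasExit) :
    ∃ (W : Set V) (D : MatrixSumShape) (Φ : MatrixSystem K (LeavittPathAlgebra K E) D),
      E.IsTerminal W ∧ Function.Bijective Φ.hom ∧
      (∀ d M, M ∈ D.grading K d ↔ Φ.hom M ∈ component K E d) ∧
      ∀ (d : ℤ) (x : LeavittPathAlgebra K E), x ∈ component K E d → x ≠ 0 →
        ∃ w ∈ W, ∃ a q, E.IsStopped W a q w ∧ ∃ z, ghostPath K E a q * x * z = vertex K E w := by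
  classical
  obtain ⟨W, hW, hcyc⟩ := hE.exists_isTerminal
  -- the paths stopped at `w`, the sinks, and the vertices of `W` on cycles
  let P : V → Type (max u v) := fun w => {x : V × List A // E.IsStopped W x.1 x.2 w}
  let T₁ := {w : V // w ∈ W ∧ ∀ e, E.s e ≠ w}
  let T₂ := {w : V // w ∈ W ∧ ∃ e, E.s e = w}
  have hPfin : ∀ w ∈ W, Finite (P w) := by
    intro w hw
    choose S hS using fun a => exists_vertex_eq_sum (K := K) hW a
    have hfin : Finite (Σ a : V, {p // p ∈ S a}) := inferInstance
    refine Finite.of_injective (β := Σ a : V, {p // p ∈ S a})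
      (fun x => ⟨x.1.1, x.1.2, ((hS _).1 _).2 ⟨w, hw, x.2⟩⟩) ?_
    rintro ⟨⟨a, p⟩, hp⟩ ⟨⟨b, q⟩, hq⟩ h
    simp only [Sigma.mk.injEq] at h
    obtain ⟨rfl, h⟩ := h
    simp only [heq_eq_eq, Subtype.mk.injEq] at h
    subst h
    rfl
  have hnil : ∀ w, E.IsStopped W w [] w := fun w => ⟨rfl, by simp⟩
  have hP₁ : ∀ w : T₁, Finite (P w.1) := fun w => hPfin w.1 w.2.1
  have hP₂ : ∀ w : T₂, Finite (P w.1) := fun w => hPfin w.1 w.2.1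
  have hPne : ∀ w, Nonempty (P w) := fun w => ⟨⟨(w, []), hnil w⟩⟩
  -- the cycles
  choose ce cq hs hpath hforced using fun w : T₂ => hcyc w.1 w.2.1 w.2.2
  have hcp : ∀ w : T₂, E.IsPath w.1 (ce w :: cq w) w.1 := fun w => ⟨hs w, (hpath w).1⟩
  choose g hg hg0 hg1 hg2 hgdeg hgne using fun w : T₂ =>
    exists_closed_path_zpow (K := K) (hcp w) (real_mul_ghostPath_of_forced (hcp w) (hforced w))
  -- the enumerations
  let i₁ : Fin (Nat.card T₁) ≃ T₁ := (Finite.equivFin T₁).symm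
  let i₂ : Fin (Nat.card T₂) ≃ T₂ := (Finite.equivFin T₂).symm
  let j₁ : ∀ i, Fin (Nat.card (P (i₁ i).1)) ≃ P (i₁ i).1 := fun i => by
    have := hP₁ (i₁ i); exact (Finite.equivFin _).symm
  let j₂ : ∀ i, Fin (Nat.card (P (i₂ i).1)) ≃ P (i₂ i).1 := fun i => by
    have := hP₂ (i₂ i); exact (Finite.equivFin _).symm
  let D : MatrixSumShape :=
    { a := Nat.card T₁
      b := Nat.card T₂
      n := fun i => Nat.card (P (i₁ i).1)
      m := fun i => Nat.card (P (i₂ i).1)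
      n_pos := fun i => by have := hP₁ (i₁ i); have := hPne (i₁ i).1; exact Nat.card_pos
      m_pos := fun i => by have := hP₂ (i₂ i); have := hPne (i₂ i).1; exact Nat.card_pos
      t := fun i => (ce (i₂ i) :: cq (i₂ i)).length
      t_pos := fun i => by simp
      δ := fun i p => (j₁ i p).1.2.length
      ε := fun i p => (j₂ i p).1.2.length }
  -- orthogonality of the paths
  have horth : ∀ w ∈ W, ∀ w' ∈ W, ∀ (p : P w) (q : P w'),
      ghostPath K E p.1.1 p.1.2 * real K E q.1.1 q.1.2 =
        if p.1 = q.1 then vertex K E w else 0 :=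
    fun w hw w' hw' p q => ghostPath_mul_real hw hw' p.2 q.2
  have hne : ∀ w w', w ≠ w' → ∀ (p : P w) (q : P w'), p.1 ≠ q.1 := by
    rintro w w' h ⟨p, hp⟩ ⟨q, hq⟩ hpq
    have hpq : p = q := hpq
    subst hpq
    exact h (hp.1.range_unique hq.1)
  have hne' : ∀ i k, (i₁ i).1 ≠ (i₂ k).1 := fun i k h => by
    obtain ⟨e, he⟩ := (i₂ k).2.2
    exact (i₁ i).2.2 e (he.trans h.symm)
  let Φ : MatrixSystem K (LeavittPathAlgebra K E) D :=
    { ρ₁ := fun i => scalarHom K (vertex K E (i₁ i).1) (vertex_mul_self _)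
      ρ₂ := fun i => laurentHom K (g (i₂ i)) (hg (i₂ i))
      x₁ := fun i p => real K E (j₁ i p).1.1 (j₁ i p).1.2
      y₁ := fun i p => ghostPath K E (j₁ i p).1.1 (j₁ i p).1.2
      x₂ := fun i p => real K E (j₂ i p).1.1 (j₂ i p).1.2
      y₂ := fun i p => ghostPath K E (j₂ i p).1.1 (j₂ i p).1.2
      h₁ := fun i p q => by
        rw [horth _ (i₁ i).2.1 _ (i₁ i).2.1]
        have h1 : scalarHom K (vertex K E (i₁ i).1) (vertex_mul_self _) (1 : K) =
          vertex K E (i₁ i).1 := one_smul K _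
        rw [h1]
        simp only [Subtype.val_inj, EmbeddingLike.apply_eq_iff_eq]
      h₂ := fun i p q => by
        rw [horth _ (i₂ i).2.1 _ (i₂ i).2.1]
        have h1 : laurentHom K (g (i₂ i)) (hg (i₂ i)) 1 = vertex K E (i₂ i).1 := by
          rw [AddMonoidAlgebra.one_def, laurentHom_single, one_smul, hg0]
        rw [h1]
        simp only [Subtype.val_inj, EmbeddingLike.apply_eq_iff_eq]
      orth₁ := fun i k h p q => by
        rw [horth _ (i₁ i).2.1 _ (i₁ k).2.1, if_neg]
        exact hne _ _ (fun h' => h (i₁.injective (Subtype.ext h'))) _ _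
      orth₂ := fun i k h p q => by
        rw [horth _ (i₂ i).2.1 _ (i₂ k).2.1, if_neg]
        exact hne _ _ (fun h' => h (i₂.injective (Subtype.ext h'))) _ _
      orth₁₂ := fun i k p q => by
        rw [horth _ (i₁ i).2.1 _ (i₂ k).2.1, if_neg]
        exact hne _ _ (hne' i k) _ _
      orth₂₁ := fun i k p q => by
        rw [horth _ (i₂ k).2.1 _ (i₁ i).2.1, if_neg]
        exact hne _ _ (hne' i k).symm _ _ }
  have htpos : ∀ i, 0 < (ce (i₂ i) :: cq (i₂ i)).length := fun i => by simp
  have hgr : ∀ d M, M ∈ D.grading K d ↔ Φ.hom M ∈ component K E d :=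
    Φ.mem_grading_iff (component K E) mul_mem_component (fun i p => real_mem _ _)
      (fun i p => ghostPath_mem _ _) (fun i p => real_mem _ _) (fun i p => ghostPath_mem _ _)
      (fun i d c => smul_vertex_mem_iff)
      (fun i d f => laurentHom_mem_iff (hg (i₂ i)) (htpos i) (hgdeg (i₂ i)) (hgne (i₂ i)))
  have hinj : Function.Injective Φ.hom := Φ.hom_injective
    (fun i => smul_left_injective K (vertex_ne_zero (i₁ i).1))
    (fun i => laurentHom_injective (hg (i₂ i)) (htpos i) (hgdeg (i₂ i)) (hgne (i₂ i)))
  -- the image contains all products `p cᵏ q*`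
  have hmem₂ : ∀ (w : T₂) (p q : P w.1) (k : ℤ),
      real K E p.1.1 p.1.2 * g w k * ghostPath K E q.1.1 q.1.2 ∈ NonUnitalAlgHom.range Φ.hom := by
    intro w p q k
    obtain ⟨i, rfl⟩ := i₂.surjective w
    obtain ⟨p, rfl⟩ := (j₂ i).surjective p
    obtain ⟨q, rfl⟩ := (j₂ i).surjective q
    refine ⟨_, (Φ.hom_single₂ i p q (AddMonoidAlgebra.single k 1)).trans ?_⟩
    change _ * laurentHom K (g (i₂ i)) (hg (i₂ i)) _ * _ = _
    rw [laurentHom_single, one_smul]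
  have hmem : ∀ w ∈ W, ∀ (p q : P w),
      real K E p.1.1 p.1.2 * ghostPath K E q.1.1 q.1.2 ∈ NonUnitalAlgHom.range Φ.hom := by
    intro w hw p q
    by_cases hsink : ∃ e, E.s e = w
    · have := hmem₂ ⟨w, hw, hsink⟩ p q 0
      rwa [hg0, real_mul_vertex p.2.1] at this
    · push Not at hsink
      obtain ⟨i, hi⟩ := i₁.surjective ⟨w, hw, hsink⟩
      have hi : (i₁ i).1 = w := congrArg Subtype.val hi
      subst hi
      obtain ⟨p, rfl⟩ := (j₁ i).surjective p
      obtain ⟨q, rfl⟩ := (j₁ i).surjective q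
      refine ⟨_, (Φ.hom_single₁ i p q 1).trans ?_⟩
      change _ * ((1 : K) • vertex K E (i₁ i).1) * _ = _
      rw [one_smul, real_mul_vertex (j₁ i p).2.1]
  choose S hS hSsum using fun a => exists_vertex_eq_sum (K := K) hW a
  have hcons : ∀ e, E.s e ∉ W → ∀ p w, E.IsStopped W (E.r e) p w →
      E.IsStopped W (E.s e) (e :: p) w := fun e he p w h =>
    ⟨⟨rfl, h.1⟩, fun f hf => by
      rcases List.mem_cons.1 hf with rfl | hf
      exacts [he, h.2 f hf]⟩
  have hsurj : Function.Surjective Φ.hom := by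
    refine fun x => mem_of_generators (NonUnitalAlgHom.range Φ.hom) ?_ ?_ ?_ x
    · intro a
      rw [hSsum a]
      refine sum_mem fun p hp => ?_
      obtain ⟨w, hw, hp⟩ := (hS a p).1 hp
      exact hmem w hw ⟨(a, p), hp⟩ ⟨(a, p), hp⟩
    · intro e
      by_cases he : E.s e ∈ W
      · have hce : ce ⟨_, he, e, rfl⟩ = e := (hforced ⟨_, he, e, rfl⟩ _ (by simp) e
          (hs ⟨_, he, e, rfl⟩).symm).symm
        have h1 := hpath ⟨_, he, e, rfl⟩
        have h2 := hmem₂ ⟨_, he, e, rfl⟩ ⟨(_, []), hnil _⟩ ⟨(_, _), h1⟩ 1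
        have h3 := real_mul_ghostPath_of_forced (K := K) h1.1
          fun f hf => hforced ⟨_, he, e, rfl⟩ f (by simp [hf])
        rw [hg1, real, vertex_mul_real (hcp ⟨_, he, e, rfl⟩), real, mul_assoc, h3, hce,
          edge_mul_vertex] at h2
        exact h2
      · rw [← edge_mul_vertex, hSsum (E.r e), Finset.mul_sum]
        refine sum_mem fun p hp => ?_
        obtain ⟨w, hw, hp⟩ := (hS _ p).1 hp
        rw [← mul_assoc]
        exact hmem w hw ⟨(E.s e, e :: p), hcons e he p w hp⟩ ⟨(E.r e, p), hp⟩
    · intro e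
      by_cases he : E.s e ∈ W
      · have hce : ce ⟨_, he, e, rfl⟩ = e := (hforced ⟨_, he, e, rfl⟩ _ (by simp) e
          (hs ⟨_, he, e, rfl⟩).symm).symm
        have h1 := hpath ⟨_, he, e, rfl⟩
        have h2 := hmem₂ ⟨_, he, e, rfl⟩ ⟨(_, _), h1⟩ ⟨(_, []), hnil _⟩ (-1)
        have h3 := real_mul_ghostPath_of_forced (K := K) h1.1
          fun f hf => hforced ⟨_, he, e, rfl⟩ f (by simp [hf])
        rw [hg2, ghostPath, mul_assoc, ghostPath_mul_vertex (hcp ⟨_, he, e, rfl⟩), ghostPath,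
          ← mul_assoc, h3, hce, vertex_mul_ghost] at h2
        exact h2
      · rw [← vertex_mul_ghost, hSsum (E.r e), Finset.sum_mul]
        refine sum_mem fun p hp => ?_
        obtain ⟨w, hw, hp⟩ := (hS _ p).1 hp
        rw [mul_assoc]
        exact hmem w hw ⟨(E.r e, p), hp⟩ ⟨(E.s e, e :: p), hcons e he p w hp⟩
  refine ⟨W, D, Φ, hW, ⟨hinj, hsurj⟩, hgr, fun d x hx hx0 => ?_⟩
  obtain ⟨M, rfl⟩ := hsurj x
  have hM := (hgr d M).2 hx
  have hM0 : (∃ i p q, M.1 i p q ≠ 0) ∨ ∃ i p q, M.2 i p q ≠ 0 := by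
    by_contra! h
    apply hx0
    have : M = 0 := Prod.ext (funext fun i => Matrix.ext fun p q => h.1 i p q)
      (funext fun i => Matrix.ext fun p q => h.2 i p q)
    rw [this, map_zero]
  rcases hM0 with ⟨i, p, q, hc⟩ | ⟨i, p, q, hc⟩
  · refine ⟨(i₁ i).1, (i₁ i).2.1, _, _, (j₁ i p).2,
      Φ.x₁ i q * ((M.1 i p q)⁻¹ • vertex K E (i₁ i).1), ?_⟩
    rw [← mul_assoc]
    refine (congrArg (· * _) (Φ.mul_hom_mul₁ M i p q)).trans ?_
    change (M.1 i p q • vertex K E (i₁ i).1) * ((M.1 i p q)⁻¹ • vertex K E (i₁ i).1) = _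
    rw [smul_mul_smul_comm, mul_inv_cancel₀ hc, one_smul, vertex_mul_self]
  · have hlau := mem_laurentGrading_iff.1 (hM.2 i p q)
    -- a homogeneous Laurent polynomial is a monomial
    obtain ⟨k, hk⟩ : ∃ k, (M.2 i p q).coeff k ≠ 0 := by
      by_contra! h
      exact hc (LaurentPolynomial.ext h)
    have hmono : M.2 i p q = AddMonoidAlgebra.single k ((M.2 i p q).coeff k) := by
      refine LaurentPolynomial.ext fun l => ?_
      rw [AddMonoidAlgebra.coeff_single, Finsupp.single_apply]
      split_ifs with h
      · rw [h]
      · by_contra hl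
        exact h (mul_left_cancel₀ (Nat.cast_ne_zero.2 (htpos i).ne')
          ((hlau k hk).trans (hlau l hl).symm))
    refine ⟨(i₂ i).1, (i₂ i).2.1, _, _, (j₂ i p).2,
      Φ.x₂ i q * (((M.2 i p q).coeff k)⁻¹ • g (i₂ i) (-k)), ?_⟩
    rw [← mul_assoc]
    refine (congrArg (· * _) (Φ.mul_hom_mul₂ M i p q)).trans ?_
    rw [hmono]
    change laurentHom K (g (i₂ i)) (hg (i₂ i)) _ * _ = _
    rw [laurentHom_single, AddMonoidAlgebra.coeff_single, Finsupp.single_eq_same,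
      smul_mul_smul_comm, mul_inv_cancel₀ hk, one_smul, ← hg, add_neg_cancel, hg0]

end LeavittPathAlgebra

/-! ### Graded semisimplicity and uniqueness -/

/-- The right ideal generated by a homogeneous idempotent `e` of degree `0` is graded simple if
every nonzero homogeneous element of it is a divisor of `e`. -/
theorem isGradedSimpleRightIdeal_mulLeft_range {K : Type*} [Field K] {R : Type*}
    [NonUnitalRing R] [Module K R] [SMulCommClass K R R]
    {𝒜 : ℤ → Submodule K R} (htop : ⨆ n, 𝒜 n = ⊤)
    (hmul : ∀ {m n : ℤ} {x y : R}, x ∈ 𝒜 m → y ∈ 𝒜 n → x * y ∈ 𝒜 (m + n))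
    {e : R} (he : e * e = e) (he0 : e ∈ 𝒜 0) (hne : e ≠ 0)
    (hdiv : ∀ n, ∀ x ∈ 𝒜 n, x ≠ 0 → e * x = x → ∃ y, x * y = e) :
    IsGradedSimpleRightIdeal 𝒜 (LinearMap.range (LinearMap.mulLeft K e)) := by
  refine ⟨⟨?_, ?_⟩, ?_, ?_⟩
  · rintro _ ⟨x, rfl⟩ y
    exact ⟨x * y, (mul_assoc e x y).symm⟩
  · rintro _ ⟨x, rfl⟩
    have hx : x ∈ ⨆ n, 𝒜 n := htop ▸ trivial
    obtain ⟨f, hf, rfl⟩ := (Submodule.mem_iSup_iff_exists_finsupp _ _).1 hx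
    rw [Finsupp.sum, map_sum]
    refine Submodule.sum_mem _ fun n _ => Submodule.mem_iSup_of_mem n ⟨⟨f n, rfl⟩, ?_⟩
    have := hmul he0 (hf n)
    rwa [zero_add] at this
  · intro h
    have : e ∈ LinearMap.range (LinearMap.mulLeft K e) := ⟨e, he⟩
    rw [h] at this
    exact hne this
  · intro J hJ hle
    by_cases hbot : J = ⊥
    · exact Or.inl hbot
    · refine Or.inr (le_antisymm hle ?_)
      have : ∃ n, J ⊓ 𝒜 n ≠ ⊥ := by
        by_contra! h
        refine hbot (eq_bot_iff.2 (hJ.2.trans ?_))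
        simp [h]
      obtain ⟨n, hn⟩ := this
      obtain ⟨x, ⟨hxJ, hxn⟩, hx0⟩ := Submodule.exists_mem_ne_zero_of_ne_bot hn
      obtain ⟨x', rfl⟩ := hle hxJ
      obtain ⟨y, hy⟩ := hdiv n _ hxn hx0 (by
        rw [LinearMap.mulLeft_apply, ← mul_assoc, he])
      rintro _ ⟨z, rfl⟩
      rw [LinearMap.mulLeft_apply, ← hy, mul_assoc]
      exact hJ.1 _ hxJ _

namespace LeavittPathAlgebra

variable {K : Type w} [Field K] {V : Type u} {A : Type v} {E : DirectedGraph V A}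

open DirectedGraph

theorem sum_vertex_mul [Fintype V] (x : LeavittPathAlgebra K E) :
    ∑ a, vertex K E a * x = x := by
  have key : ∀ {a : V} {x : LeavittPathAlgebra K E}, vertex K E a * x = x →
      ∑ b, vertex K E b * x = x := by
    intro a x hx
    rw [Finset.sum_eq_single_of_mem a (Finset.mem_univ a), hx]
    intro b _ hb
    rw [← hx, ← mul_assoc, vertex_mul_vertex_of_ne hb, zero_mul]
  refine mem_of_generators
    { carrier := {x : LeavittPathAlgebra K E | ∑ a, vertex K E a * x = x}
      add_mem' := fun {x y} hx hy => by
        simp only [Set.mem_ofPred_eq, mul_add, Finset.sum_add_distrib] at *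
        rw [hx, hy]
      zero_mem' := by simp
      mul_mem' := fun {x y} hx hy => by
        simp only [Set.mem_ofPred_eq, ← mul_assoc, ← Finset.sum_mul] at *
        rw [hx]
      smul_mem' := fun r x hx => by
        simp only [Set.mem_ofPred_eq, mul_smul_comm, ← Finset.smul_sum] at *
        rw [hx] } (fun a => key (vertex_mul_self a)) (fun e => key (vertex_mul_edge e))
    (fun e => key (vertex_mul_ghost e)) x

/-- The idempotents `p p*`, for paths `p` stopped in a terminal set, generate graded simple right
ideals whose sum is everything. -/
theorem isGradedSemisimple [Finite V] [Finite A] (hE : E.NoCycleHasExit) :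
    IsGradedSemisimple (component K E) := by
  classical
  have := Fintype.ofFinite V
  obtain ⟨W, D, Φ, hW, -, -, hdiv⟩ := exists_matrixSystem (K := K) hE
  choose S hS hsum using fun a => exists_vertex_eq_sum (K := K) hW a
  have hsimple : ∀ a, ∀ p ∈ S a, IsGradedSimpleRightIdeal (component K E)
      (LinearMap.range (LinearMap.mulLeft K (real K E a p * ghostPath K E a p))) := by
    intro a p hp
    obtain ⟨w, hw, hp⟩ := (hS a p).1 hp
    have hidem : real K E a p * ghostPath K E a p * (real K E a p * ghostPath K E a p) =
        real K E a p * ghostPath K E a p := by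
      rw [mul_assoc, ← mul_assoc (ghostPath K E a p), ghostPath_mul_real_self hp.1,
        vertex_mul_ghostPath hp.1]
    have hinner : ghostPath K E a p * (real K E a p * ghostPath K E a p) * real K E a p =
        vertex K E w := by
      rw [mul_assoc, mul_assoc, ghostPath_mul_real_self hp.1, real_mul_vertex hp.1,
        ghostPath_mul_real_self hp.1]
    refine isGradedSimpleRightIdeal_mulLeft_range iSup_component mul_mem_component hidem ?_ ?_ ?_
    · have := mul_mem_component (real_mem (K := K) (E := E) a p) (ghostPath_mem a p)
      rwa [add_neg_cancel] at this
    · intro h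
      rw [h, mul_zero, zero_mul] at hinner
      exact vertex_ne_zero w hinner.symm
    · intro n x hx hx0 hpx
      obtain ⟨w', hw', b, q, hq, z, hz⟩ := hdiv n x hx hx0
      -- the path `q` has to be `p`, since `q* p` is nonzero
      have hqp : (b, q) = (a, p) := by
        by_contra h
        rw [← hpx, ← mul_assoc, ← mul_assoc, ghostPath_mul_real hw' hw hq hp, if_neg h, zero_mul,
          zero_mul, zero_mul] at hz
        exact vertex_ne_zero w' hz.symm
      obtain ⟨rfl, rfl⟩ := Prod.mk.inj hqp
      have hww' : w' = w := hq.1.range_unique hp.1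
      subst hww'
      refine ⟨z * ghostPath K E b q, ?_⟩
      calc x * (z * ghostPath K E b q)
          = real K E b q * (ghostPath K E b q * x * z) * ghostPath K E b q := by
            conv_lhs => rw [← hpx]
            simp only [mul_assoc]
        _ = _ := by rw [hz, real_mul_vertex hq.1]
  refine eq_top_iff.2 fun x _ => ?_
  rw [← sum_vertex_mul x]
  refine Submodule.sum_mem _ fun a _ => ?_
  rw [hsum a, Finset.sum_mul]
  refine Submodule.sum_mem _ fun p hp => ?_
  have hle : LinearMap.range (LinearMap.mulLeft K (real K E a p * ghostPath K E a p)) ≤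
      sSup {I | IsGradedSimpleRightIdeal (component K E) I} := le_sSup (hsimple a p hp)
  exact hle ⟨x, rfl⟩

theorem isGradedMatrixSum [Finite V] [Finite A] (hE : E.NoCycleHasExit) :
    IsGradedMatrixSum (component K E) := by
  obtain ⟨W, D, Φ, -, hbij, hgr, -⟩ := exists_matrixSystem (K := K) hE
  obtain ⟨ψ, h1, h2⟩ : ∃ ψ : LeavittPathAlgebra K E →ₙₐ[K] D.Carrier K,
      Function.LeftInverse ψ Φ.hom ∧ Function.RightInverse ψ Φ.hom :=
    ⟨NonUnitalAlgHom.inverse Φ.hom (Function.invFun Φ.hom)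
      (Function.leftInverse_invFun hbij.1) (Function.rightInverse_invFun hbij.2),
      Function.leftInverse_invFun hbij.1, Function.rightInverse_invFun hbij.2⟩
  exact ⟨D, ψ, ⟨h2.injective, h1.surjective⟩, fun n x => by rw [hgr, h2 x]⟩

/-- The graded uniqueness theorem, for finite graphs in which no cycle has an exit: a homomorphism
which respects degrees and kills no vertex is injective, since every nonzero homogeneous element
divides a vertex. -/
theorem injective_of_map_vertex_ne_zero [Finite V] [Finite A] (hE : E.NoCycleHasExit)
    {V' A' : Type*} {F : DirectedGraph V' A'}
    (φ : LeavittPathAlgebra K E →ₙₐ[K] LeavittPathAlgebra K F)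
    (hdeg : ∀ n, ∀ x ∈ component K E n, φ x ∈ component K F n)
    (hv : ∀ a, φ (vertex K E a) ≠ 0) : Function.Injective φ := by
  obtain ⟨W, D, Φ, -, -, -, hdiv⟩ := exists_matrixSystem (K := K) hE
  refine (injective_iff_map_eq_zero φ).2 fun x hx => ?_
  obtain ⟨s, f, hf, rfl⟩ := exists_components x
  rw [map_sum] at hx
  have h0 := eq_zero_of_sum_eq_zero (fun n => hdeg n _ (hf n)) hx
  refine Finset.sum_eq_zero fun n hn => ?_
  by_contra hne
  obtain ⟨w, -, a, q, -, z, hz⟩ := hdiv n _ (hf n) hne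
  apply hv w
  rw [← hz, map_mul, map_mul, h0 n hn, mul_zero, zero_mul]

/-- An injective homomorphism which respects degrees also reflects them. -/
theorem mem_component_iff_map {V' A' : Type*} {F : DirectedGraph V' A'}
    (φ : LeavittPathAlgebra K E →ₙₐ[K] LeavittPathAlgebra K F) (hinj : Function.Injective φ)
    (hdeg : ∀ n, ∀ x ∈ component K E n, φ x ∈ component K F n) {n : ℤ}
    {x : LeavittPathAlgebra K E} : x ∈ component K E n ↔ φ x ∈ component K F n := by
  refine ⟨hdeg n x, fun h => ?_⟩
  obtain ⟨s, f, hf, rfl⟩ := exists_components x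
  refine Submodule.sum_mem _ fun m hm => ?_
  by_cases hmn : m = n
  · exact hmn ▸ hf m
  · have h1 : proj K F m (φ (∑ k ∈ s, f k)) = 0 := proj_of_mem_of_ne h (Ne.symm hmn)
    rw [map_sum, map_sum, Finset.sum_eq_single_of_mem m hm
      fun k _ hk => proj_of_mem_of_ne (hdeg k _ (hf k)) hk, proj_of_mem (hdeg m _ (hf m))] at h1
    rw [hinj (toUnital_injective K F (h1.trans (map_zero _).symm) |>.trans (map_zero φ).symm)]
    exact zero_mem _

end LeavittPathAlgebra

/-! ### Subalgebras generated by finite subgraphs -/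

namespace DirectedGraph

/-- An embedding of directed graphs: injective maps on vertices and edges which respect sources and
ranges. -/
structure Embedding {V' A' V A : Type*} (G : DirectedGraph V' A') (E : DirectedGraph V A) where
  onV : V' → V
  onA : A' → A
  injV : Function.Injective onV
  injA : Function.Injective onA
  s_onA : ∀ e, E.s (onA e) = onV (G.s e)
  r_onA : ∀ e, E.r (onA e) = onV (G.r e)

namespace Embedding

variable {V' A' V A : Type*} {G : DirectedGraph V' A'} {E : DirectedGraph V A}
  (ι : G.Embedding E)

/-- The vertex `x` of the subgraph is complete if it emits edges in the big graph and all of them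
belong to the subgraph. -/
def Complete (x : V') : Prop :=
  (∃ f, E.s f = ι.onV x) ∧ ∀ f, E.s f = ι.onV x → f ∈ Set.range ι.onA

/-- The graph whose Leavitt path algebra is the subalgebra generated by a subgraph `G`. A vertex `x`
of `G` which emits edges in `G` and is not complete is split into a vertex `inl x`, which emits the
edges of `G`, and a sink `inr x`, which stands for the remaining part of `x`. Every other vertex has
only one of the two copies: `inl x` if it is complete, `inr x` if it emits no edges in `G`. -/
def splitGraph : DirectedGraph ({x // ∃ e, G.s e = x} ⊕ {x // ¬ ι.Complete x})
    ({e // ∃ f, G.s f = G.r e} ⊕ {e // ¬ ι.Complete (G.r e)}) where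
  s
    | .inl e => .inl ⟨G.s e.1, e.1, rfl⟩
    | .inr e => .inl ⟨G.s e.1, e.1, rfl⟩
  r
    | .inl e => .inl ⟨G.r e.1, e.2⟩
    | .inr e => .inr ⟨G.r e.1, e.2⟩

/-- The edge of the subgraph below an edge of the split graph. -/
def baseA (e : {e // ∃ f, G.s f = G.r e} ⊕ {e // ¬ ι.Complete (G.r e)}) : A' :=
  e.elim Subtype.val Subtype.val

/-- The vertex of the subgraph below a vertex of the split graph. -/
def baseV (x : {x // ∃ e, G.s e = x} ⊕ {x // ¬ ι.Complete x}) : V' :=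
  x.elim Subtype.val Subtype.val

theorem baseV_s (e) : ι.baseV (ι.splitGraph.s e) = G.s (ι.baseA e) := by
  rcases e with e | e <;> rfl

theorem baseV_r (e) : ι.baseV (ι.splitGraph.r e) = G.r (ι.baseA e) := by
  rcases e with e | e <;> rfl

theorem exists_s_eq_inl (e) : ∃ x, ι.splitGraph.s e = .inl x := by
  rcases e with e | e <;> exact ⟨_, rfl⟩

theorem s_inj {e f} (h : ι.onV (ι.baseV (ι.splitGraph.s e)) = ι.onV (ι.baseV (ι.splitGraph.s f))) :
    ι.splitGraph.s e = ι.splitGraph.s f := by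
  have := ι.injV h
  rw [baseV_s, baseV_s] at this
  rcases e with e | e <;> rcases f with f | f <;>
    exact congrArg Sum.inl (Subtype.ext this)

theorem isPath_map {a b p} (h : ι.splitGraph.IsPath a p b) :
    E.IsPath (ι.onV (ι.baseV a)) (p.map fun e => ι.onA (ι.baseA e)) (ι.onV (ι.baseV b)) := by
  induction p generalizing a with
  | nil => exact congrArg (fun x => ι.onV (ι.baseV x)) h
  | cons e p ih =>
    refine ⟨?_, ?_⟩
    · rw [ι.s_onA, ← baseV_s, h.1]
    · rw [ι.r_onA, ← baseV_r]
      exact ih h.2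

theorem isCycle_map {p} (h : ι.splitGraph.IsCycle p) :
    E.IsCycle (p.map fun e => ι.onA (ι.baseA e)) := by
  obtain ⟨h1, ⟨a, h2⟩, h3⟩ := h
  refine ⟨by simpa using h1, ⟨_, ι.isPath_map h2⟩, ?_⟩
  rw [List.map_map]
  refine (List.nodup_map_iff_inj_on (List.Nodup.of_map _ h3)).2 fun e he f hf hef => ?_
  simp only [Function.comp_apply, ι.s_onA, ← baseV_s] at hef
  exact List.inj_on_of_nodup_map h3 he hf (ι.s_inj hef)

end Embedding

theorem IsPath.exists_source_eq {V A : Type*} {E : DirectedGraph V A} {a b : V} {p : List A}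
    (hp : E.IsPath a p b) {e : A} (he : e ∈ p) : E.r e = b ∨ ∃ f ∈ p, E.s f = E.r e := by
  induction p generalizing a with
  | nil => cases he
  | cons f p ih =>
    rcases List.mem_cons.1 he with rfl | he
    · cases p with
      | nil => exact Or.inl hp.2
      | cons g p => exact Or.inr ⟨g, by simp, hp.2.1⟩
    · rcases ih hp.2 he with h | ⟨g, hg, h⟩
      exacts [Or.inl h, Or.inr ⟨g, List.mem_cons_of_mem _ hg, h⟩]

/-- The range of an edge on a closed path is the source of an edge on it. -/
theorem IsPath.exists_source_eq_of_closed {V A : Type*} {E : DirectedGraph V A} {a : V}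
    {p : List A} (hp : E.IsPath a p a) {e : A} (he : e ∈ p) : ∃ f ∈ p, E.s f = E.r e := by
  rcases hp.exists_source_eq he with h | h
  · cases p with
    | nil => cases he
    | cons g p => exact ⟨g, by simp, hp.1.trans h.symm⟩
  · exact h

/-- A vertex on a cycle without exits is complete as soon as its edge on the cycle belongs to the
subgraph, so splitting the incomplete vertices creates no exits. -/
theorem Embedding.noCycleHasExit_splitGraph {V' A' V A : Type*} {G : DirectedGraph V' A'}
    {E : DirectedGraph V A} (ι : G.Embedding E) (hE : E.NoCycleHasExit) :
    ι.splitGraph.NoCycleHasExit := by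
  rintro p hp ⟨f, e, he, hs, hne⟩
  have hcyc := hE _ (ι.isCycle_map hp)
  -- the edges on the cycle are the only edges with their sources
  have hforced : ∀ e ∈ p, ∀ g, E.s g = E.s (ι.onA (ι.baseA e)) → g = ι.onA (ι.baseA e) :=
    fun e he g hg => by
      by_contra h
      exact hcyc ⟨g, _, List.mem_map.2 ⟨e, he, rfl⟩, hg, h⟩
  obtain ⟨-, ⟨a, hpa⟩, -⟩ := hp
  have hinl : ∀ e ∈ p, ∃ x, ι.splitGraph.r e = .inl x := fun e he => by
    obtain ⟨g, -, hg⟩ := hpa.exists_source_eq_of_closed he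
    exact hg ▸ ι.exists_s_eq_inl g
  have hcomplete : ι.Complete (G.r (ι.baseA e)) := by
    obtain ⟨g, hgp, hg⟩ := hpa.exists_source_eq_of_closed he
    have hg' : E.s (ι.onA (ι.baseA g)) = ι.onV (G.r (ι.baseA e)) := by
      rw [ι.s_onA, ← baseV_s, hg, baseV_r]
    exact ⟨⟨_, hg'⟩, fun k hk => ⟨_, (hforced g hgp k (hk.trans hg'.symm)).symm⟩⟩
  have hbase : ι.baseA f = ι.baseA e := ι.injA <| hforced e he _ <| by
    rw [ι.s_onA, ι.s_onA, ← baseV_s, ← baseV_s, hs]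
  obtain ⟨x, hx⟩ := hinl e he
  rcases e with e | e
  · rcases f with f | f
    · exact hne (congrArg Sum.inl (Subtype.ext hbase))
    · have h : ι.Complete (G.r f.1) := by
        have hb : f.1 = e.1 := hbase
        rw [hb]; exact hcomplete
      exact f.2 h
  · cases hx

end DirectedGraph

namespace LeavittPathAlgebra

open DirectedGraph

theorem sum_subtype_of_forall_eq_zero {α M : Type*} [Fintype α] [AddCommMonoid M]
    {p : α → Prop} [Fintype {a // p a}] (f : α → M) (h : ∀ a, ¬ p a → f a = 0) :
    ∑ a : {a // p a}, f a = ∑ a, f a := by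
  classical
  rw [← Finset.sum_subtype (Finset.univ.filter p) (by simp) f]
  exact Finset.sum_filter_of_ne fun a _ ha => not_not.1 fun hp => ha (h a hp)

variable {K : Type w} [Field K] {V : Type u} {A : Type v} {E : DirectedGraph V A}
  {V' A' : Type*} [Fintype A'] {G : DirectedGraph V' A'} (ι : G.Embedding E)

open Classical in
variable (K) in
/-- The part `∑ e e*` of a vertex `x` of the subgraph which belongs to the edges of the subgraph. -/
noncomputable def emitted (x : V') : LeavittPathAlgebra K E :=
  ∑ e with G.s e = x, edge K E (ι.onA e) * ghost K E (ι.onA e)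

theorem vertex_mul_emitted (x : V') :
    vertex K E (ι.onV x) * emitted K ι x = emitted K ι x := by
  classical
  rw [emitted, Finset.mul_sum]
  refine Finset.sum_congr rfl fun e he => ?_
  rw [← (Finset.mem_filter.1 he).2, ← ι.s_onA, ← mul_assoc, vertex_mul_edge]

theorem emitted_mul_vertex (x : V') :
    emitted K ι x * vertex K E (ι.onV x) = emitted K ι x := by
  classical
  rw [emitted, Finset.sum_mul]
  refine Finset.sum_congr rfl fun e he => ?_
  rw [← (Finset.mem_filter.1 he).2, ← ι.s_onA, mul_assoc, ghost_mul_vertex]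

theorem emitted_mul_edge (e : A') :
    emitted K ι (G.s e) * edge K E (ι.onA e) = edge K E (ι.onA e) := by
  rw [emitted, Finset.sum_mul, Finset.sum_eq_single_of_mem e (by simp)]
  · rw [mul_assoc, ghost_mul_edge_self, edge_mul_vertex]
  · intro f _ hf
    rw [mul_assoc, ghost_mul_edge_of_ne fun h => hf (ι.injA h), mul_zero]

theorem ghost_mul_emitted (e : A') :
    ghost K E (ι.onA e) * emitted K ι (G.s e) = ghost K E (ι.onA e) := by
  rw [emitted, Finset.mul_sum, Finset.sum_eq_single_of_mem e (by simp)]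
  · rw [← mul_assoc, ghost_mul_edge_self, vertex_mul_ghost]
  · intro f _ hf
    rw [← mul_assoc, ghost_mul_edge_of_ne fun h => hf (ι.injA h.symm), zero_mul]

theorem emitted_mul_self (x : V') : emitted K ι x * emitted K ι x = emitted K ι x := by
  classical
  have h : ∀ y, emitted K ι x * y =
      ∑ e with G.s e = x, edge K E (ι.onA e) * ghost K E (ι.onA e) * y := fun y => by
    rw [emitted, Finset.sum_mul]
  rw [h]
  refine Finset.sum_congr rfl fun e he => ?_
  rw [← (Finset.mem_filter.1 he).2, mul_assoc, ghost_mul_emitted]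

theorem emitted_eq_zero {x : V'} (h : ¬ ∃ e, G.s e = x) : emitted K ι x = 0 := by
  classical
  exact Finset.sum_eq_zero fun e he => absurd ⟨e, (Finset.mem_filter.1 he).2⟩ h

theorem emitted_eq_vertex {x : V'} (h : ι.Complete x) :
    emitted K ι x = vertex K E (ι.onV x) := by
  classical
  have hset : {f : A | E.s f = ι.onV x} = ι.onA '' {e | G.s e = x} := by
    ext f
    constructor
    · intro hf
      obtain ⟨e, rfl⟩ := h.2 f hf
      exact ⟨e, ι.injV ((ι.s_onA e).symm.trans hf), rfl⟩
    · rintro ⟨e, rfl, rfl⟩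
      exact ι.s_onA e
  have hfin : {f : A | E.s f = ι.onV x}.Finite := hset ▸ (Set.toFinite _).image _
  rw [vertex_eq_sum _ h.1 hfin, emitted]
  have : hfin.toFinset = (Finset.univ.filter fun e => G.s e = x).image ι.onA := by
    ext f
    rw [Set.Finite.mem_toFinset, hset]
    simp
  rw [this, Finset.sum_image fun _ _ _ _ h => ι.injA h]

theorem emitted_ne_zero {x : V'} (h : ∃ e, G.s e = x) : emitted K ι x ≠ 0 := by
  obtain ⟨e, rfl⟩ := h
  intro h
  have h1 := emitted_mul_edge (K := K) ι e
  rw [h, zero_mul] at h1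
  have h2 := ghost_mul_edge_self (K := K) (E := E) (ι.onA e)
  rw [← h1, mul_zero] at h2
  exact vertex_ne_zero _ h2.symm

/-- The complement of the emitted part of an incomplete vertex is nonzero: either the vertex is a
sink, or it emits an edge which is not in the subgraph. -/
theorem vertex_sub_emitted_ne_zero {x : V'} (h : ¬ ι.Complete x) :
    vertex K E (ι.onV x) - emitted K ι x ≠ 0 := by
  intro h0
  by_cases hx : ∃ f, E.s f = ι.onV x
  · have : ∃ f, E.s f = ι.onV x ∧ f ∉ Set.range ι.onA := by
      by_contra! hc
      exact h ⟨hx, hc⟩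
    obtain ⟨f, hf, hfr⟩ := this
    have h1 : emitted K ι x * edge K E f = 0 := by
      rw [emitted, Finset.sum_mul]
      refine Finset.sum_eq_zero fun e _ => ?_
      rw [mul_assoc, ghost_mul_edge_of_ne fun h => hfr ⟨e, h⟩, mul_zero]
    rw [← sub_eq_zero.1 h0, ← hf, vertex_mul_edge] at h1
    have h2 := ghost_mul_edge_self (K := K) (E := E) f
    rw [h1, mul_zero] at h2
    exact vertex_ne_zero _ h2.symm
  · rw [emitted_eq_zero ι fun ⟨e, he⟩ => hx ⟨ι.onA e, he ▸ ι.s_onA e⟩, sub_zero] at h0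
    exact vertex_ne_zero _ h0

variable (K) in
/-- The idempotent of `L_K(E)` which belongs to a vertex of the split graph. -/
noncomputable def splitVertex :
    {x // ∃ e, G.s e = x} ⊕ {x // ¬ ι.Complete x} → LeavittPathAlgebra K E
  | .inl x => emitted K ι x.1
  | .inr x => vertex K E (ι.onV x.1) - emitted K ι x.1

theorem vertex_mul_splitVertex (x) :
    vertex K E (ι.onV (ι.baseV x)) * splitVertex K ι x = splitVertex K ι x := by
  rcases x with x | x
  · exact vertex_mul_emitted ι _
  · change vertex K E (ι.onV x.1) * (_ - _) = (_ - _)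
    rw [mul_sub, vertex_mul_self, vertex_mul_emitted]

theorem splitVertex_mul_vertex (x) :
    splitVertex K ι x * vertex K E (ι.onV (ι.baseV x)) = splitVertex K ι x := by
  rcases x with x | x
  · exact emitted_mul_vertex ι _
  · change (_ - _) * vertex K E (ι.onV x.1) = (_ - _)
    rw [sub_mul, vertex_mul_self, emitted_mul_vertex]

theorem splitVertex_mul_self (x) : splitVertex K ι x * splitVertex K ι x = splitVertex K ι x := by
  rcases x with x | x
  · exact emitted_mul_self ι _
  · change (_ - _) * (_ - _) = (_ - _)
    rw [mul_sub, sub_mul, sub_mul, vertex_mul_self, vertex_mul_emitted, emitted_mul_vertex,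
      emitted_mul_self, sub_self, sub_zero]

theorem splitVertex_mul_splitVertex {x y} (h : x ≠ y) :
    splitVertex K ι x * splitVertex K ι y = 0 := by
  by_cases hb : ι.baseV x = ι.baseV y
  · rcases x with ⟨x, hx⟩ | ⟨x, hx⟩ <;> rcases y with ⟨y, hy⟩ | ⟨y, hy⟩ <;>
      (obtain rfl : x = y := hb)
    · exact absurd rfl h
    · change emitted K ι x * (_ - emitted K ι x) = 0
      rw [mul_sub, emitted_mul_vertex, emitted_mul_self, sub_self]
    · change (_ - emitted K ι x) * emitted K ι x = 0
      rw [sub_mul, vertex_mul_emitted, emitted_mul_self, sub_self]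
    · exact absurd rfl h
  · rw [← splitVertex_mul_vertex, ← vertex_mul_splitVertex ι y, mul_assoc,
      ← mul_assoc (vertex K E _), vertex_mul_vertex_of_ne fun h => hb (ι.injV h), zero_mul,
      mul_zero]

theorem splitVertex_ne_zero (x) : splitVertex K ι x ≠ 0 := by
  rcases x with x | x
  · exact emitted_ne_zero ι x.2
  · exact vertex_sub_emitted_ne_zero ι x.2

variable (K) in
/-- The Leavitt family of the split graph in `L_K(E)`. -/
noncomputable def splitFamily : LeavittFamily ι.splitGraph (LeavittPathAlgebra K E) where
  vertex := splitVertex K ι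
  edge e := edge K E (ι.onA (ι.baseA e)) * splitVertex K ι (ι.splitGraph.r e)
  ghost e := splitVertex K ι (ι.splitGraph.r e) * ghost K E (ι.onA (ι.baseA e))
  vertex_idem := splitVertex_mul_self ι
  vertex_orth _ _ h := splitVertex_mul_splitVertex ι h
  source_edge e := by
    have h : splitVertex K ι (ι.splitGraph.s e) = emitted K ι (G.s (ι.baseA e)) := by
      rcases e with e | e <;> rfl
    rw [h, ← mul_assoc, emitted_mul_edge]
  edge_range e := by rw [mul_assoc, splitVertex_mul_self]
  range_ghost e := by rw [← mul_assoc, splitVertex_mul_self]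
  ghost_source e := by
    have h : splitVertex K ι (ι.splitGraph.s e) = emitted K ι (G.s (ι.baseA e)) := by
      rcases e with e | e <;> rfl
    rw [h, mul_assoc, ghost_mul_emitted]
  ck1_same e := by
    rw [mul_assoc, ← mul_assoc (ghost K E _), ghost_mul_edge_self, ι.r_onA, ← ι.baseV_r,
      vertex_mul_splitVertex, splitVertex_mul_self]
  ck1_ne e f h := by
    rw [mul_assoc, ← mul_assoc (ghost K E _)]
    by_cases hb : ι.baseA e = ι.baseA f
    · have hr : ι.splitGraph.r e ≠ ι.splitGraph.r f := by
        rcases e with e | e <;> rcases f with f | f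
        · exact absurd (congrArg Sum.inl (Subtype.ext hb)) h
        · exact Sum.inl_ne_inr
        · exact Sum.inr_ne_inl
        · exact absurd (congrArg Sum.inr (Subtype.ext hb)) h
      rw [hb, ghost_mul_edge_self, ι.r_onA, ← ι.baseV_r, vertex_mul_splitVertex,
        splitVertex_mul_splitVertex ι hr]
    · rw [ghost_mul_edge_of_ne fun h => hb (ι.injA h), zero_mul, mul_zero]
  ck2 a hne hfin := by
    classical
    obtain ⟨e₀, rfl⟩ := hne
    obtain ⟨x, hx⟩ : ∃ x, ι.splitGraph.s e₀ = .inl x := ι.exists_s_eq_inl e₀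
    have hfilter : hfin.toFinset = Finset.univ.filter fun e => ι.splitGraph.s e = .inl x := by
      ext e; simp [hx]
    have hs₁ : ∀ e : {e // ∃ f, G.s f = G.r e},
        ι.splitGraph.s (.inl e) = .inl x ↔ G.s e.1 = x.1 := fun e =>
      ⟨fun h => congrArg Subtype.val (Sum.inl_injective h),
        fun h => congrArg Sum.inl (Subtype.ext h)⟩
    have hs₂ : ∀ e : {e // ¬ ι.Complete (G.r e)},
        ι.splitGraph.s (.inr e) = .inl x ↔ G.s e.1 = x.1 := fun e =>
      ⟨fun h => congrArg Subtype.val (Sum.inl_injective h),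
        fun h => congrArg Sum.inl (Subtype.ext h)⟩
    rw [hfilter, hx, Finset.sum_filter, Fintype.sum_sum_type]
    simp only [hs₁, hs₂]
    -- both sums extend to all edges of the subgraph, since the additional terms vanish
    have h₁ : ∑ e : {e // ∃ f, G.s f = G.r e}, (if G.s e.1 = x.1 then edge K E (ι.onA e.1) *
        emitted K ι (G.r e.1) * ghost K E (ι.onA e.1) else 0) =
        ∑ e, if G.s e = x.1 then edge K E (ι.onA e) * emitted K ι (G.r e) *
          ghost K E (ι.onA e) else 0 :=
      sum_subtype_of_forall_eq_zero (fun e => if G.s e = x.1 then edge K E (ι.onA e) *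
        emitted K ι (G.r e) * ghost K E (ι.onA e) else 0) fun e he => by
          rw [emitted_eq_zero ι he, mul_zero, zero_mul, ite_self]
    have h₂ : ∑ e : {e // ¬ ι.Complete (G.r e)}, (if G.s e.1 = x.1 then edge K E (ι.onA e.1) *
        (vertex K E (ι.onV (G.r e.1)) - emitted K ι (G.r e.1)) * ghost K E (ι.onA e.1) else 0) =
        ∑ e, if G.s e = x.1 then edge K E (ι.onA e) *
          (vertex K E (ι.onV (G.r e)) - emitted K ι (G.r e)) * ghost K E (ι.onA e) else 0 :=
      sum_subtype_of_forall_eq_zero (fun e => if G.s e = x.1 then edge K E (ι.onA e) *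
        (vertex K E (ι.onV (G.r e)) - emitted K ι (G.r e)) * ghost K E (ι.onA e) else 0)
        fun e he => by
          rw [emitted_eq_vertex ι (not_not.1 he), sub_self, mul_zero, zero_mul, ite_self]
    have h₃ : ∀ e, edge K E (ι.onA (ι.baseA e)) * splitVertex K ι (ι.splitGraph.r e) *
        (splitVertex K ι (ι.splitGraph.r e) * ghost K E (ι.onA (ι.baseA e))) =
        edge K E (ι.onA (ι.baseA e)) * splitVertex K ι (ι.splitGraph.r e) *
          ghost K E (ι.onA (ι.baseA e)) := fun e => by
      rw [mul_assoc, ← mul_assoc (splitVertex K ι _) (splitVertex K ι _), splitVertex_mul_self,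
        mul_assoc]
    simp only [h₃]
    refine Eq.trans ?_ (congrArg₂ (· + ·) h₁ h₂).symm
    rw [← Finset.sum_add_distrib]
    change emitted K ι x.1 = _
    rw [emitted, Finset.sum_filter]
    refine Finset.sum_congr rfl fun e _ => ?_
    split_ifs
    · rw [← add_mul, ← mul_add, add_sub_cancel, ← ι.r_onA, edge_mul_vertex]
    · rw [add_zero]

variable (K) in
/-- The homomorphism from the Leavitt path algebra of the split graph to `L_K(E)`. -/
noncomputable def splitHom :
    LeavittPathAlgebra K ι.splitGraph →ₙₐ[K] LeavittPathAlgebra K E :=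
  (splitFamily K ι).lift K

theorem splitHom_vertex (x) : splitHom K ι (vertex K _ x) = splitVertex K ι x :=
  LeavittFamily.lift_vertex (splitFamily K ι) x

theorem splitHom_edge (e) : splitHom K ι (edge K _ e) =
    edge K E (ι.onA (ι.baseA e)) * splitVertex K ι (ι.splitGraph.r e) :=
  LeavittFamily.lift_edge (splitFamily K ι) e

theorem splitHom_ghost (e) : splitHom K ι (ghost K _ e) =
    splitVertex K ι (ι.splitGraph.r e) * ghost K E (ι.onA (ι.baseA e)) :=
  LeavittFamily.lift_ghost (splitFamily K ι) e

theorem mul_mem_component_of_eq {m n k : ℤ} (h : m + n = k) {x y : LeavittPathAlgebra K E}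
    (hx : x ∈ component K E m) (hy : y ∈ component K E n) : x * y ∈ component K E k :=
  h ▸ mul_mem_component hx hy

theorem emitted_mem (x : V') : emitted K ι x ∈ component K E 0 := by
  rw [emitted]
  exact Submodule.sum_mem _ fun e _ => mul_mem_component_of_eq (add_neg_cancel 1)
    (edge_mem _) (ghost_mem _)

theorem splitVertex_mem (x) : splitVertex K ι x ∈ component K E 0 := by
  rcases x with x | x
  · exact emitted_mem ι _
  · exact sub_mem (vertex_mem _) (emitted_mem ι _)

theorem splitHom_mem (n : ℤ) (x) (hx : x ∈ component K ι.splitGraph n) :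
    splitHom K ι x ∈ component K E n := by
  refine map_mem_component (splitHom K ι) (fun a => ?_) (fun e => ?_) (fun e => ?_) hx
  · rw [splitHom_vertex]; exact splitVertex_mem ι a
  · rw [splitHom_edge]
    exact mul_mem_component_of_eq (add_zero 1) (edge_mem _) (splitVertex_mem ι _)
  · rw [splitHom_ghost]
    exact mul_mem_component_of_eq (zero_add (-1)) (splitVertex_mem ι _) (ghost_mem _)

variable (K) in
/-- The subalgebra of `L_K(E)` generated by the vertices, edges and ghost edges of a subgraph. -/
def subgraphAlgebra {V' A' : Type*} {G : DirectedGraph V' A'} (ι : G.Embedding E) :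
    NonUnitalSubalgebra K (LeavittPathAlgebra K E) :=
  NonUnitalAlgebra.adjoin K (Set.range (fun x => vertex K E (ι.onV x)) ∪
    (Set.range (fun e => edge K E (ι.onA e)) ∪ Set.range fun e => ghost K E (ι.onA e)))

theorem range_splitHom : NonUnitalAlgHom.range (splitHom K ι) = subgraphAlgebra K ι := by
  have hv : ∀ x, vertex K E (ι.onV x) ∈ subgraphAlgebra K ι := fun x =>
    NonUnitalAlgebra.subset_adjoin K (.inl ⟨x, rfl⟩)
  have he : ∀ e, edge K E (ι.onA e) ∈ subgraphAlgebra K ι := fun e =>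
    NonUnitalAlgebra.subset_adjoin K (.inr (.inl ⟨e, rfl⟩))
  have hg : ∀ e, ghost K E (ι.onA e) ∈ subgraphAlgebra K ι := fun e =>
    NonUnitalAlgebra.subset_adjoin K (.inr (.inr ⟨e, rfl⟩))
  have hemit : ∀ x, emitted K ι x ∈ subgraphAlgebra K ι := fun x =>
    sum_mem fun e _ => mul_mem (he e) (hg e)
  have hsplit : ∀ x, splitVertex K ι x ∈ subgraphAlgebra K ι := by
    rintro (x | x)
    exacts [hemit _, sub_mem (hv _) (hemit _)]
  apply le_antisymm
  · rintro _ ⟨x, rfl⟩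
    refine mem_of_generators ((subgraphAlgebra K ι).comap (splitHom K ι)) (fun a => ?_)
      (fun e => ?_) (fun e => ?_) x
    · change splitHom K ι _ ∈ subgraphAlgebra K ι
      rw [splitHom_vertex]; exact hsplit a
    · change splitHom K ι _ ∈ subgraphAlgebra K ι
      rw [splitHom_edge]; exact mul_mem (he _) (hsplit _)
    · change splitHom K ι _ ∈ subgraphAlgebra K ι
      rw [splitHom_ghost]; exact mul_mem (hsplit _) (hg _)
  · set B := NonUnitalAlgHom.range (splitHom K ι) with hB
    have hemit₀ : ∀ x (hx : ∃ e, G.s e = x), emitted K ι x ∈ B := fun x hx =>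
      ⟨vertex K _ (.inl ⟨x, hx⟩), splitHom_vertex ι _⟩
    have hrest₀ : ∀ x (_ : ¬ ι.Complete x), vertex K E (ι.onV x) - emitted K ι x ∈ B :=
      fun x hx => ⟨vertex K _ (.inr ⟨x, hx⟩), splitHom_vertex ι _⟩
    -- a vertex, an edge or a ghost edge is the sum of its two parts, one of which may vanish
    have key : ∀ (y z : LeavittPathAlgebra K E) (x : V'),
        ((∃ e, G.s e = x) → y * emitted K ι x * z ∈ B) →
        (¬ ι.Complete x → y * (vertex K E (ι.onV x) - emitted K ι x) * z ∈ B) →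
        y * vertex K E (ι.onV x) * z ∈ B := by
      intro y z x h1 h2
      have : y * vertex K E (ι.onV x) * z = y * emitted K ι x * z +
          y * (vertex K E (ι.onV x) - emitted K ι x) * z := by
        rw [← add_mul, ← mul_add, add_sub_cancel]
      rw [this]
      refine add_mem ?_ ?_
      · by_cases hx : ∃ e, G.s e = x
        · exact h1 hx
        · rw [emitted_eq_zero ι hx, mul_zero, zero_mul]; exact zero_mem _
      · by_cases hx : ι.Complete x
        · rw [emitted_eq_vertex ι hx, sub_self, mul_zero, zero_mul]; exact zero_mem _
        · exact h2 hx
    refine NonUnitalAlgebra.adjoin_le ?_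
    rintro _ (⟨x, rfl⟩ | ⟨e, rfl⟩ | ⟨e, rfl⟩)
    · have := key (vertex K E (ι.onV x)) (vertex K E (ι.onV x)) x
        (fun hx => by rw [vertex_mul_emitted, emitted_mul_vertex]; exact hemit₀ x hx)
        (fun hx => by
          rw [mul_sub, sub_mul, vertex_mul_self, vertex_mul_emitted, vertex_mul_self,
            emitted_mul_vertex]
          exact hrest₀ x hx)
      rwa [vertex_mul_self, vertex_mul_self] at this
    · have := key (edge K E (ι.onA e)) (vertex K E (ι.onV (G.r e))) (G.r e)
        (fun hx => by
          rw [mul_assoc, emitted_mul_vertex]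
          exact ⟨edge K _ (.inl ⟨e, hx⟩), splitHom_edge ι _⟩)
        (fun hx => by
          rw [mul_assoc, sub_mul, vertex_mul_self, emitted_mul_vertex]
          exact ⟨edge K _ (.inr ⟨e, hx⟩), splitHom_edge ι _⟩)
      rwa [mul_assoc, vertex_mul_self, ← ι.r_onA, edge_mul_vertex] at this
    · have := key (vertex K E (ι.onV (G.r e))) (ghost K E (ι.onA e)) (G.r e)
        (fun hx => by
          rw [vertex_mul_emitted]
          exact ⟨ghost K _ (.inl ⟨e, hx⟩), splitHom_ghost ι _⟩)
        (fun hx => by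
          rw [mul_sub, vertex_mul_self, vertex_mul_emitted]
          exact ⟨ghost K _ (.inr ⟨e, hx⟩), splitHom_ghost ι _⟩)
      rwa [vertex_mul_self, ← ι.r_onA, vertex_mul_ghost] at this

end LeavittPathAlgebra

/-! ### Arbitrary graphs in which no cycle has an exit -/

section GradedIsomorphic

variable {K : Type*} [Field K] {R S T : Type*} [NonUnitalRing R] [Module K R] [NonUnitalRing S]
  [Module K S] [NonUnitalRing T] [Module K T] {𝒜 : ℤ → Submodule K R} {ℬ : ℤ → Submodule K S}
  {𝒞 : ℤ → Submodule K T}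

theorem GradedIsomorphic.symm (h : GradedIsomorphic 𝒜 ℬ) : GradedIsomorphic ℬ 𝒜 := by
  obtain ⟨φ, hφ, hgr⟩ := h
  have hl := Function.leftInverse_invFun hφ.1
  have hr := Function.rightInverse_invFun hφ.2
  refine ⟨NonUnitalAlgHom.inverse φ (Function.invFun φ) hl hr, ⟨hr.injective, hl.surjective⟩,
    fun n x => ?_⟩
  rw [hgr, NonUnitalAlgHom.coe_inverse, hr]

theorem GradedIsomorphic.trans (h : GradedIsomorphic 𝒜 ℬ) (h' : GradedIsomorphic ℬ 𝒞) :
    GradedIsomorphic 𝒜 𝒞 := by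
  obtain ⟨φ, hφ, hgr⟩ := h
  obtain ⟨ψ, hψ, hgr'⟩ := h'
  exact ⟨ψ.comp φ, hψ.comp hφ, fun n x => (hgr n x).trans (hgr' n _)⟩

end GradedIsomorphic

namespace DirectedGraph

/-- Finitely many vertices and edges lie in a finite subgraph. -/
theorem exists_embedding {V : Type u} {A : Type v} (E : DirectedGraph V A) (S : Set V)
    (hS : S.Finite) (T : Set A) (hT : T.Finite) :
    ∃ (n m : ℕ) (G : DirectedGraph (Fin n) (Fin m)) (ι : G.Embedding E),
      S ⊆ Set.range ι.onV ∧ T ⊆ Set.range ι.onA := by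
  have hS' : (S ∪ (E.s '' T ∪ E.r '' T)).Finite := hS.union ((hT.image _).union (hT.image _))
  set S' := S ∪ (E.s '' T ∪ E.r '' T)
  have := hS'.to_subtype
  have := hT.to_subtype
  let i := Finite.equivFin S'
  let j := Finite.equivFin T
  have hs : ∀ e : T, E.s e ∈ S' := fun e => .inr (.inl ⟨e, e.2, rfl⟩)
  have hr : ∀ e : T, E.r e ∈ S' := fun e => .inr (.inr ⟨e, e.2, rfl⟩)
  refine ⟨Nat.card S', Nat.card T,
    ⟨fun e => i ⟨_, hs (j.symm e)⟩, fun e => i ⟨_, hr (j.symm e)⟩⟩,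
    { onV := fun x => (i.symm x).1
      onA := fun e => (j.symm e).1
      injV := Subtype.val_injective.comp i.symm.injective
      injA := Subtype.val_injective.comp j.symm.injective
      s_onA := fun e => (congrArg Subtype.val (i.symm_apply_apply ⟨_, hs _⟩)).symm
      r_onA := fun e => (congrArg Subtype.val (i.symm_apply_apply ⟨_, hr _⟩)).symm },
    fun a ha => ⟨i ⟨a, .inl ha⟩, congrArg Subtype.val (i.symm_apply_apply _)⟩,
    fun e he => ⟨j ⟨e, he⟩, congrArg Subtype.val (j.symm_apply_apply _)⟩⟩

end DirectedGraph

namespace LeavittPathAlgebra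

open DirectedGraph

variable {K : Type w} [Field K] {V : Type u} {A : Type v} {E : DirectedGraph V A}

theorem subgraphAlgebra_mono {V₁ A₁ V₂ A₂ : Type*} {G₁ : DirectedGraph V₁ A₁}
    {G₂ : DirectedGraph V₂ A₂} (ι₁ : G₁.Embedding E) (ι₂ : G₂.Embedding E)
    (hV : Set.range ι₁.onV ⊆ Set.range ι₂.onV) (hA : Set.range ι₁.onA ⊆ Set.range ι₂.onA) :
    subgraphAlgebra K ι₁ ≤ subgraphAlgebra K ι₂ := by
  refine NonUnitalAlgebra.adjoin_mono (Set.union_subset_union ?_ (Set.union_subset_union ?_ ?_))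
  · rintro _ ⟨x, rfl⟩
    obtain ⟨y, hy⟩ := hV ⟨x, rfl⟩
    exact ⟨y, by simp only [hy]⟩
  · rintro _ ⟨x, rfl⟩
    obtain ⟨y, hy⟩ := hA ⟨x, rfl⟩
    exact ⟨y, by simp only [hy]⟩
  · rintro _ ⟨x, rfl⟩
    obtain ⟨y, hy⟩ := hA ⟨x, rfl⟩
    exact ⟨y, by simp only [hy]⟩

/-- If no cycle of `E` has an exit, the subalgebra generated by a finite subgraph is graded and
isomorphic to the Leavitt path algebra of the split graph. -/
theorem subgraphAlgebra_isGradedSubalgebra_and_gradedIsomorphic {V' A' : Type*} [Finite V']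
    [Fintype A'] {G : DirectedGraph V' A'} (ι : G.Embedding E) (hE : E.NoCycleHasExit) :
    IsGradedSubalgebra (component K E) (subgraphAlgebra K ι) ∧
      GradedIsomorphic (component K ι.splitGraph)
        (inducedGrading (component K E) (subgraphAlgebra K ι)) := by
  have hinj : Function.Injective (splitHom K ι) :=
    injective_of_map_vertex_ne_zero (ι.noCycleHasExit_splitGraph hE) _ (splitHom_mem ι)
      fun a => by rw [splitHom_vertex]; exact splitVertex_ne_zero ι a
  have hmem : ∀ x, splitHom K ι x ∈ subgraphAlgebra K ι := fun x =>
    range_splitHom (K := K) ι ▸ ⟨x, rfl⟩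
  let φ := NonUnitalAlgHom.codRestrict (splitHom K ι) (subgraphAlgebra K ι) hmem
  have hφ : Function.Surjective φ := by
    rintro ⟨b, hb⟩
    rw [← range_splitHom] at hb
    obtain ⟨x, rfl⟩ := hb
    exact ⟨x, rfl⟩
  refine ⟨eq_top_iff.2 fun b _ => ?_, φ, ⟨fun x y h => hinj (congrArg Subtype.val h), hφ⟩,
    fun n x => mem_component_iff_map (splitHom K ι) hinj (splitHom_mem ι)⟩
  obtain ⟨x, rfl⟩ := hφ b
  obtain ⟨s, f, hf, rfl⟩ := exists_components x
  rw [map_sum]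
  exact Submodule.sum_mem _ fun n _ => Submodule.mem_iSup_of_mem n (splitHom_mem ι n _ (hf n))

/-- If no cycle of `E` has an exit, `L_K(E)` is the directed union of the subalgebras generated by
finite subgraphs. -/
theorem isDirectedUnionOfGraded_of_noCycleHasExit (hE : E.NoCycleHasExit) :
    IsDirectedUnionOfGraded (component K E) fun B =>
      IsGradedSemisimpleLeavitt (inducedGrading (component K E) B) ∧
        IsGradedMatrixSum (inducedGrading (component K E) B) := by
  set 𝒮 : Set (NonUnitalSubalgebra K (LeavittPathAlgebra K E)) :=
    {B | ∃ (n m : ℕ) (G : DirectedGraph (Fin n) (Fin m)) (ι : G.Embedding E),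
      B = subgraphAlgebra K ι}
  have hdir : DirectedOn (· ≤ ·) 𝒮 := by
    rintro _ ⟨n₁, m₁, G₁, ι₁, rfl⟩ _ ⟨n₂, m₂, G₂, ι₂, rfl⟩
    obtain ⟨n, m, G, ι, hV, hA⟩ := E.exists_embedding
      (Set.range ι₁.onV ∪ Set.range ι₂.onV) (Set.toFinite _)
      (Set.range ι₁.onA ∪ Set.range ι₂.onA) (Set.toFinite _)
    rw [Set.union_subset_iff] at hV hA
    exact ⟨_, ⟨n, m, G, ι, rfl⟩, subgraphAlgebra_mono ι₁ ι hV.1 hA.1,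
      subgraphAlgebra_mono ι₂ ι hV.2 hA.2⟩
  refine ⟨𝒮, hdir, ?_, ?_⟩
  · refine mem_of_generators
      { carrier := {x | ∃ B ∈ 𝒮, x ∈ B}
        add_mem' := ?_
        zero_mem' := ?_
        mul_mem' := ?_
        smul_mem' := ?_ } ?_ ?_ ?_
    · rintro x y ⟨B₁, h1, hx⟩ ⟨B₂, h2, hy⟩
      obtain ⟨B, hB, hle1, hle2⟩ := hdir B₁ h1 B₂ h2
      exact ⟨B, hB, add_mem (hle1 hx) (hle2 hy)⟩
    · obtain ⟨n, m, G, ι, -⟩ := E.exists_embedding ∅ Set.finite_empty ∅ Set.finite_empty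
      exact ⟨_, ⟨n, m, G, ι, rfl⟩, zero_mem _⟩
    · rintro x y ⟨B₁, h1, hx⟩ ⟨B₂, h2, hy⟩
      obtain ⟨B, hB, hle1, hle2⟩ := hdir B₁ h1 B₂ h2
      exact ⟨B, hB, mul_mem (hle1 hx) (hle2 hy)⟩
    · rintro r x ⟨B, hB, hx⟩
      exact ⟨B, hB, SMulMemClass.smul_mem r hx⟩
    · intro a
      obtain ⟨n, m, G, ι, h, -⟩ := E.exists_embedding {a} (Set.finite_singleton a) ∅
        Set.finite_empty
      obtain ⟨x, rfl⟩ := h rfl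
      exact ⟨_, ⟨n, m, G, ι, rfl⟩, NonUnitalAlgebra.subset_adjoin K (.inl ⟨x, rfl⟩)⟩
    · intro e
      obtain ⟨n, m, G, ι, -, h⟩ := E.exists_embedding ∅ Set.finite_empty {e}
        (Set.finite_singleton e)
      obtain ⟨x, rfl⟩ := h rfl
      exact ⟨_, ⟨n, m, G, ι, rfl⟩, NonUnitalAlgebra.subset_adjoin K (.inr (.inl ⟨x, rfl⟩))⟩
    · intro e
      obtain ⟨n, m, G, ι, -, h⟩ := E.exists_embedding ∅ Set.finite_empty {e}
        (Set.finite_singleton e)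
      obtain ⟨x, rfl⟩ := h rfl
      exact ⟨_, ⟨n, m, G, ι, rfl⟩, NonUnitalAlgebra.subset_adjoin K (.inr (.inr ⟨x, rfl⟩))⟩
  · rintro _ ⟨n, m, G, ι, rfl⟩
    obtain ⟨hgr, hiso⟩ :=
      subgraphAlgebra_isGradedSubalgebra_and_gradedIsomorphic (K := K) ι hE
    have hF := ι.noCycleHasExit_splitGraph hE
    obtain ⟨D, hD⟩ := isGradedMatrixSum (K := K) hF
    exact ⟨hgr, ⟨_, _, inferInstance, inferInstance, ι.splitGraph, isGradedSemisimple hF,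
      hiso.symm⟩, D, hiso.symm.trans hD⟩

end LeavittPathAlgebra

theorem theorem3p6 {V : Type u} {A : Type v} (E : DirectedGraph V A) (K : Type w) [Field K] :
    List.TFAE
      [IsGradedDirectlyFinite (LeavittPathAlgebra.component K E)
          (Set.range (LeavittPathAlgebra.vertex K E)),
        E.NoCycleHasExit,
        IsDirectedUnionOfGraded (LeavittPathAlgebra.component K E) fun B =>
          IsGradedSemisimpleLeavitt (inducedGrading (LeavittPathAlgebra.component K E) B) ∧
            IsGradedMatrixSum (inducedGrading (LeavittPathAlgebra.component K E) B),
        IsDirectedUnionOfGraded (LeavittPathAlgebra.component K E) fun B =>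
          IsGradedMatrixSum (inducedGrading (LeavittPathAlgebra.component K E) B),
        IsDirectlyFinite (LeavittPathAlgebra K E)] := by
  tfae_have 1 → 2 := LeavittPathAlgebra.noCycleHasExit_of_isGradedDirectlyFinite
  tfae_have 2 → 3 := LeavittPathAlgebra.isDirectedUnionOfGraded_of_noCycleHasExit
  tfae_have 3 → 4 := fun ⟨𝒮, h1, h2, h3⟩ => ⟨𝒮, h1, h2, fun B hB => ⟨(h3 B hB).1, (h3 B hB).2.2⟩⟩
  tfae_have 4 → 5 := isDirectlyFinite_of_isDirectedUnionOfGraded _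
  tfae_have 5 → 1 := LeavittPathAlgebra.isGradedDirectlyFinite_of_isDirectlyFinite
  tfae_finish
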